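/- Let $M$ be a compact connected oriented smooth $3$-manifold with non-empty boundary, let $\hat M$ be the space obtained from $M$ by collapsing each boundary component to a point, and let $V\subset\hat M$ be the set of these points. An ideal triangulation $T$ of $\hat M$ is a realization of $\hat M$ by finitely many abstract tetrahedra whose $2$-faces are glued in pairs, with $V$ as set of vertices (self and multiple adjacencies are allowed). Let $\Sigma$ be the dual spine, with singular graph $\mathrm{Sing}(\Sigma)$ (vertices dual to tetrahedra, edges dual to $2$-faces, regions dual to edges of $T$). A pre-branching $\omega$ of $T$ is an orientation of the edges of $\mathrm{Sing}(\Sigma)$, equivalently a system of transverse orientations of the $2$-faces of $T$, such that at each vertex of $\mathrm{Sing}(\Sigma)$ two edge-branches are ingoing and two are outgoing. It is therefore a $1$-cycle, with a class $[\omega]\in H_1(M;\mathbb{Z})$. The ideal $pb$-transit equivalence on pre-branched ideal triangulations $(T,\omega)$ of $\hat M$ is generated by isotopies of $\hat M$ fixing $V$ pointwise, by the $2\to 3$ moves (two distinct tetrahedra with a common face are replaced by three tetrahedra around a new edge) and by the quadrilateral $0\to 2$ moves (a quadrilateral made by two distinct triangles with a common edge is replaced by a pillow made by two tetrahedra glued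 along a copy of the quadrilateral with the other diagonal). In each move the transverse orientations are required to agree on the persistent faces, those of the pillow boundary being two copies of those of the quadrilateral. A branching $b$ of $T$ is a system of edge orientations which on each abstract tetrahedron is induced by a total ordering of its vertices. Orient each region of $\Sigma$ so that it has intersection number $+1$ with its dual $b$-oriented edge. The pre-branching $\omega_b$ gives each edge of $\mathrm{Sing}(\Sigma)$ the prevailing one of the three boundary orientations induced by the incident regions. Then, for every pre-branched ideal triangulation $(T,\omega)$ of $\hat M$: (1) the class $[\omega]\in H_1(M;\mathbb{Z})$ is invariant under the ideal $pb$-transit equivalence: if $(T',\omega')$ is equivalent to $(T,\omega)$, then $[\omega']=[\omega]$; (2) the reduction mod $2$ of $[\omega]$ vanishes: $[\omega]_2=0\in H_1(M;\mathbb{Z}/2\mathbb{Z})$; (3) $[\omega]$ is even: $[\omega]=2\alpha$ for some $\alpha\in H_1(M;\mathbb{Z})$; (4) if $\omega=\omega_b$ for some branching $b$ of $T$, then $[\omega]=0$. -/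

import Mathlib

open scoped Manifold ContDiff

/-! ## The space obtained from a manifold by collapsing its boundary components -/

section Collapse

variable (M : Type) [TopologicalSpace M] [ChartedSpace (EuclideanHalfSpace 3) M]

/-- Two points of `M` are identified when they are equal or lie in the same connected component
of the boundary of `M`. -/
def boundaryCollapseSetoid : Setoid M where
  r x y := x = y ∨ (x ∈ (𝓡∂ 3).boundary M ∧ y ∈ connectedComponentIn ((𝓡∂ 3).boundary M) x)
  iseqv :=
    { refl := fun x => Or.inl rfl
      symm := by
        rintro x y (rfl | ⟨hx, hy⟩)
        · exact Or.inl rfl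
        · refine Or.inr ⟨connectedComponentIn_subset _ _ hy, ?_⟩
          rw [← connectedComponentIn_eq hy]
          exact mem_connectedComponentIn hx
      trans := by
        rintro x y z (rfl | ⟨hx, hy⟩) (rfl | ⟨hy', hz⟩)
        · exact Or.inl rfl
        · exact Or.inr ⟨hy', hz⟩
        · exact Or.inr ⟨hx, hy⟩
        · refine Or.inr ⟨hx, ?_⟩
          rw [connectedComponentIn_eq hy]
          exact hz }

/-- The pseudomanifold `M̂`: each connected component of `∂M` is collapsed to one point. -/
def CollapsedManifold : Type := Quotient (boundaryCollapseSetoid M)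

instance : TopologicalSpace (CollapsedManifold M) :=
  inferInstanceAs (TopologicalSpace (Quotient (boundaryCollapseSetoid M)))

namespace CollapsedManifold

/-- The quotient map `M → M̂`. -/
def proj : M → CollapsedManifold M := Quotient.mk (boundaryCollapseSetoid M)

/-- The set `V ⊆ M̂` of the points coming from the boundary components. -/
def marked : Set (CollapsedManifold M) := proj M '' (𝓡∂ 3).boundary M

variable {M}

lemma proj_eq_iff_of_interior {x y : M} (hx : x ∈ (𝓡∂ 3).interior M) :
    proj M x = proj M y ↔ x = y := by
  constructor
  · intro h
    rcases (Quotient.exact h : (boundaryCollapseSetoid M).r x y) with h | h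
    · exact h
    · exact absurd h.1 (((𝓡∂ 3).isInteriorPoint_iff_not_isBoundaryPoint x).1 hx)
  · rintro rfl; rfl

lemma proj_mem_marked_iff (x : M) : proj M x ∈ marked M ↔ x ∈ (𝓡∂ 3).boundary M := by
  constructor
  · rintro ⟨y, hy, hxy⟩
    by_contra hx
    have hx' : x ∈ (𝓡∂ 3).interior M :=
      ((𝓡∂ 3).isInteriorPoint_iff_not_isBoundaryPoint x).2 hx
    exact hx ((proj_eq_iff_of_interior hx').1 hxy.symm ▸ hy)
  · exact fun h => ⟨x, h, rfl⟩

variable (M) in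
/-- The quotient map embeds the interior of `M` onto `M̂ ∖ V`. -/
noncomputable def interiorHomeo [IsManifold (𝓡∂ 3) ∞ M] :
    (𝓡∂ 3).interior M ≃ₜ {p : CollapsedManifold M // p ∉ marked M} :=
  Equiv.toHomeomorphOfContinuousOpen
    (Equiv.ofBijective
      (fun x => ⟨proj M x.1, fun h => ((𝓡∂ 3).isInteriorPoint_iff_not_isBoundaryPoint x.1).1 x.2
        ((proj_mem_marked_iff x.1).1 h)⟩)
      ⟨fun x y h => Subtype.ext ((proj_eq_iff_of_interior x.2).1 (congrArg Subtype.val h)), by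
        rintro ⟨p, hp⟩
        obtain ⟨x, rfl⟩ := Quotient.exists_rep p
        exact ⟨⟨x, ((𝓡∂ 3).isInteriorPoint_iff_not_isBoundaryPoint x).2
          fun h => hp ⟨x, h, rfl⟩⟩, rfl⟩⟩)
    (by
      refine Continuous.subtype_mk ?_ _
      exact continuous_quotient_mk'.comp continuous_subtype_val)
    (by
      intro U hU
      have hint : IsOpen ((𝓡∂ 3).interior M) :=
        (𝓡∂ 3).isOpen_interior (n := ∞) (by simp)
      have hU' : IsOpen (Subtype.val '' U : Set M) := hint.isOpenMap_subtype_val U hU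
      have hpre : proj M ⁻¹' (proj M '' (Subtype.val '' U)) = Subtype.val '' U := by
        ext y
        constructor
        · rintro ⟨x, hx, hxy⟩
          have hxi : x ∈ (𝓡∂ 3).interior M := by
            obtain ⟨z, -, rfl⟩ := hx; exact z.2
          exact (proj_eq_iff_of_interior hxi).1 hxy ▸ hx
        · exact fun h => ⟨y, h, rfl⟩
      have hopen : IsOpen (proj M '' (Subtype.val '' U)) :=
        isOpen_coinduced.2 (show IsOpen (proj M ⁻¹' _) from hpre.symm ▸ hU')
      refine ⟨_, hopen, ?_⟩
      ext ⟨p, hp⟩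
      constructor
      · rintro ⟨_, ⟨z, hz, rfl⟩, hzp⟩
        exact ⟨z, hz, Subtype.ext hzp⟩
      · rintro ⟨z, hz, hzp⟩
        exact ⟨z.1, ⟨z, hz, rfl⟩, congrArg Subtype.val hzp⟩)

end CollapsedManifold

end Collapse

/-! ## Gluings of tetrahedra, branchings and pre-branchings -/

/-- Finitely many abstract tetrahedra, each with vertices labelled by `Fin 4`, whose faces are glued
in pairs, no face remaining unglued; self and multiple adjacencies are allowed. The face of the
tetrahedron `i` opposite to the vertex `k` is glued to the face of `nbr i k` opposite to the vertex
`perm i k k`, the vertex `v ≠ k` of `i` going to the vertex `perm i k v`. -/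
structure TetGluing where
  n : ℕ
  nbr : Fin n → Fin 4 → Fin n
  perm : Fin n → Fin 4 → Equiv.Perm (Fin 4)
  nbr_nbr : ∀ i k, nbr (nbr i k) (perm i k k) = i
  perm_perm : ∀ i k, perm (nbr i k) (perm i k k) = (perm i k)⁻¹
  no_fixed_face : ∀ i k, (nbr i k, perm i k k) ≠ (i, k)

/-- The standard tetrahedron, in barycentric coordinates. -/
abbrev Tetra : Type := stdSimplex ℝ (Fin 4)

namespace TetGluing

variable (G : TetGluing)

/-- The elementary identifications between points of faces of the abstract tetrahedra. -/
inductive Rel : Fin G.n × Tetra → Fin G.n × Tetra → Prop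
  | glue (i : Fin G.n) (k : Fin 4) (x : Tetra) (hx : x k = 0) :
      Rel (i, x) (G.nbr i k, stdSimplex.map (G.perm i k) x)

/-- The geometric realization. -/
def Space : Type := Quot G.Rel

instance : TopologicalSpace G.Space := inferInstanceAs (TopologicalSpace (Quot G.Rel))

/-- The point of the realization with barycentric coordinates `x` in the tetrahedron `i`. -/
def point (i : Fin G.n) (x : Tetra) : G.Space := Quot.mk _ (i, x)

lemma map_perm_apply (g : Equiv.Perm (Fin 4)) (x : Tetra) (v : Fin 4) :
    (stdSimplex.map g x) (g v) = x v := by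
  simp only [stdSimplex.map_coe, FunOnFinite.linearMap_apply_apply]
  rw [Finset.sum_eq_single v] <;> simp +contextual

/-- Being (the class of) a vertex of some tetrahedron. -/
def IsVertex (p : G.Space) : Prop :=
  Quot.lift (fun a : Fin G.n × Tetra => ∃ v, a.2 v = 1) (by
    rintro _ _ ⟨i, k, x, hx⟩
    refine propext ⟨fun ⟨v, hv⟩ => ⟨G.perm i k v, ?_⟩, fun ⟨v, hv⟩ => ⟨(G.perm i k).symm v, ?_⟩⟩
    · exact (map_perm_apply _ _ _).trans hv
    · have := map_perm_apply (G.perm i k) x ((G.perm i k).symm v)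
      rw [Equiv.apply_symm_apply] at this
      exact this.symm.trans hv) p

/-- A coherent orientation of the tetrahedra: the orientation of the `i`-th one is `sgn i` times
that given by the order `0, 1, 2, 3` of its vertices, and glued faces get opposite boundary
orientations. -/
structure Orientation where
  sgn : Fin G.n → ℤˣ
  glue : ∀ i k, sgn (G.nbr i k) = - (Equiv.Perm.sign (G.perm i k) * sgn i)

/-- A pre-branching, as a system of transverse orientations of the `2`-faces, or equivalently of
orientations of the dual edges: `out i k` holds when the transverse orientation of the face of `i`
opposite to `k` points out of `i`. At every tetrahedron two of the four dual edges are outgoing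
and two are ingoing. -/
structure PreBranching where
  out : Fin G.n → Fin 4 → Bool
  glue : ∀ i k, out (G.nbr i k) (G.perm i k k) = !(out i k)
  two_out : ∀ i, (Finset.univ.filter fun k => out i k = true).card = 2

/-- A branching: edge orientations, compatible with the gluings, which on each tetrahedron are
induced by a total order of the vertices. The order is given by the rank of each vertex, and the
edge `ab` of `i` is oriented from `a` to `b` when `rank i a < rank i b`. -/
structure Branching where
  rank : Fin G.n → Equiv.Perm (Fin 4)
  glue : ∀ i k a b, a ≠ k → b ≠ k →
    (rank i a < rank i b ↔ rank (G.nbr i k) (G.perm i k a) < rank (G.nbr i k) (G.perm i k b))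

/-- Let the regions of the dual spine be oriented so that each branching-oriented edge of the
triangulation meets its dual region with intersection number `+1`. A permutation `p` with `p 3 = k`
and `rank (p 0) < rank (p 1)` is an oriented edge `p 0 → p 1` of the face opposite to `k` (with
third vertex `p 2`). The boundary orientation which the region dual to that edge induces on the edge
of the spine dual to the face points out of the tetrahedron exactly when the ordered vertices
`p 0, p 1, p 2, p 3` are negatively oriented. This is the set of those oriented edges. -/
def outwardInducing (s : ℤˣ) (ρ : Equiv.Perm (Fin 4)) (k : Fin 4) :
    Finset (Equiv.Perm (Fin 4)) :=
  Finset.univ.filter fun p => p 3 = k ∧ ρ (p 0) < ρ (p 1) ∧ Equiv.Perm.sign p * s = -1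

lemma card_outwardInducing (s : ℤˣ) (ρ : Equiv.Perm (Fin 4)) (k : Fin 4) :
    2 ≤ (outwardInducing s ρ k).card ↔
      Equiv.Perm.sign ρ * s * (-1) ^ (ρ k : ℕ) = 1 := by
  have key : ∀ (ε : ℤˣ) (j : Fin 4),
      2 ≤ (Finset.univ.filter fun q : Equiv.Perm (Fin 4) =>
        q 3 = j ∧ q 0 < q 1 ∧ Equiv.Perm.sign q * ε = -1).card ↔ ε * (-1) ^ (j : ℕ) = 1 := by
    decide +kernel
  rw [← key]
  have : (outwardInducing s ρ k).card = (Finset.univ.filter fun q : Equiv.Perm (Fin 4) =>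
        q 3 = ρ k ∧ q 0 < q 1 ∧ Equiv.Perm.sign q * (Equiv.Perm.sign ρ * s) = -1).card := by
    refine Finset.card_equiv (Equiv.mulLeft ρ) fun p => ?_
    have h : Equiv.Perm.sign ρ * Equiv.Perm.sign p * (Equiv.Perm.sign ρ * s)
        = Equiv.Perm.sign p * s := by
      rw [mul_comm (Equiv.Perm.sign ρ) (Equiv.Perm.sign p), mul_assoc,
        ← mul_assoc (Equiv.Perm.sign ρ), Int.units_mul_self, one_mul]
    simp [outwardInducing, h]
  rw [this]

variable {G}

/-- The pre-branching `ω_b` induced by a branching `b` in the oriented case: each edge of the dual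
spine gets the prevailing one among the three boundary orientations induced by the incident oriented
regions. -/
def Branching.toPreBranching (b : G.Branching) (o : G.Orientation) : G.PreBranching where
  out i k := decide (2 ≤ (outwardInducing (o.sgn i) (b.rank i) k).card)
  glue i k := by
    have key : ∀ (τ : Equiv.Perm (Fin 4)) (j : Fin 4),
        (∀ a b, a ≠ j → b ≠ j → (a < b ↔ τ a < τ b)) →
        Equiv.Perm.sign τ = (-1) ^ (j : ℕ) * (-1) ^ (τ j : ℕ) := by decide +kernel
    have h := key (b.rank (G.nbr i k) * G.perm i k * (b.rank i)⁻¹) (b.rank i k) (by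
      intro x y hx hy
      have := b.glue i k ((b.rank i).symm x) ((b.rank i).symm y)
        (fun e => hx (by rw [← e, Equiv.apply_symm_apply]))
        (fun e => hy (by rw [← e, Equiv.apply_symm_apply]))
      rw [Equiv.apply_symm_apply, Equiv.apply_symm_apply] at this
      exact this)
    have hk : (b.rank i)⁻¹ (b.rank i k) = k := Equiv.symm_apply_apply _ _
    simp only [Equiv.Perm.sign_mul, Equiv.Perm.sign_inv, Equiv.Perm.mul_apply, hk] at h
    rw [← decide_not, decide_eq_decide, card_outwardInducing, card_outwardInducing, o.glue]
    generalize (-1 : ℤˣ) ^ ((b.rank i k : Fin 4) : ℕ) = u at *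
    generalize (-1 : ℤˣ) ^ ((b.rank (G.nbr i k) (G.perm i k k) : Fin 4) : ℕ) = u' at *
    generalize Equiv.Perm.sign (b.rank i) = c at *
    generalize Equiv.Perm.sign (b.rank (G.nbr i k)) = c' at *
    generalize Equiv.Perm.sign (G.perm i k) = d at *
    generalize o.sgn i = s at *
    clear key hk
    revert h
    revert u u' c c' d s
    decide
  two_out i := by
    have key : ∀ c : ℤˣ, (Finset.univ.filter fun j : Fin 4 => c * (-1) ^ (j : ℕ) = 1).card = 2 := by
      decide
    refine Eq.trans ?_ (key (Equiv.Perm.sign (b.rank i) * o.sgn i))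
    refine Finset.card_equiv (b.rank i) fun k => ?_
    simp only [Finset.mem_filter, Finset.mem_univ, true_and, decide_eq_true_eq,
      card_outwardInducing]

end TetGluing

/-! ## Ideal triangulations and the homology class of a pre-branching -/

/-- An ideal triangulation of `M̂`: a gluing of tetrahedra whose realization is identified with
`M̂`, in such a way that the set of vertices is `V`. -/
structure IdealTriangulation (M : Type) [TopologicalSpace M]
    [ChartedSpace (EuclideanHalfSpace 3) M] where
  gluing : TetGluing
  homeo : gluing.Space ≃ₜ CollapsedManifold M
  isVertex_iff : ∀ p, gluing.IsVertex p ↔ homeo p ∈ CollapsedManifold.marked M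

section DualEdges

/-- The affine path, parametrized by the standard `1`-simplex, from the barycenter of a tetrahedron
to the barycenter of its face opposite to `k`. -/
noncomputable def halfDualEdge (k : Fin 4) (u : stdSimplex ℝ (Fin 2)) : Tetra :=
  ⟨fun v => u.1 0 * (1 / 4) + u.1 1 * (if v = k then 0 else 1 / 3), by
    have h0 := u.2.1 0
    have h1 := u.2.1 1
    have hs : u.1 0 + u.1 1 = 1 := by rw [← u.2.2, Fin.sum_univ_two]
    refine ⟨fun v => by dsimp only; split_ifs <;> positivity, ?_⟩
    have : ∑ v : Fin 4, (if v = k then (0 : ℝ) else 1 / 3) = 1 := by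
      fin_cases k <;> simp [Fin.sum_univ_four] <;> norm_num
    rw [Finset.sum_add_distrib, ← Finset.mul_sum, ← Finset.mul_sum, this]
    simp [hs]⟩

lemma continuous_halfDualEdge (k : Fin 4) : Continuous (halfDualEdge k) := by
  refine Continuous.subtype_mk (continuous_pi fun v => ?_) _
  have h : ∀ j : Fin 2, Continuous fun u : stdSimplex ℝ (Fin 2) => u.1 j :=
    fun j => (continuous_apply j).comp continuous_subtype_val
  exact ((h 0).mul continuous_const).add ((h 1).mul continuous_const)

lemma halfDualEdge_ne_one (k : Fin 4) (u : stdSimplex ℝ (Fin 2)) (v : Fin 4) :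
    (halfDualEdge k u : Tetra) v ≠ 1 := by
  have h0 := u.2.1 0
  have h1 := u.2.1 1
  have hs : u.1 0 + u.1 1 = 1 := by rw [← u.2.2, Fin.sum_univ_two]
  change u.1 0 * (1 / 4) + u.1 1 * (if v = k then 0 else 1 / 3) ≠ 1
  split_ifs <;> intro h <;> linarith

namespace IdealTriangulation

open CategoryTheory AlgebraicTopology

variable {M : Type} [TopologicalSpace M] [ChartedSpace (EuclideanHalfSpace 3) M]
  [IsManifold (𝓡∂ 3) ∞ M] (T : IdealTriangulation M)

/-- The half of a dual edge which lies in the tetrahedron `i` and ends on the face opposite to `k`,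
as a singular `1`-simplex of (the interior of) `M`. -/
noncomputable def dualPath (i : Fin T.gluing.n) (k : Fin 4) :
    C(stdSimplex ℝ (Fin 2), M) where
  toFun u := ((CollapsedManifold.interiorHomeo M).symm
    ⟨T.homeo (T.gluing.point i (halfDualEdge k u)), fun h => by
      obtain ⟨v, hv⟩ := (T.isVertex_iff _).2 h
      exact halfDualEdge_ne_one k u v hv⟩).1
  continuous_toFun := by
    refine continuous_subtype_val.comp ((CollapsedManifold.interiorHomeo M).symm.continuous.comp
      (Continuous.subtype_mk (T.homeo.continuous.comp ?_) _))
    exact continuous_quot_mk.comp (continuous_const.prodMk (continuous_halfDualEdge k))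

/-- `dualPath` as a simplex of the singular simplicial set of `M`. -/
noncomputable def dualSimplex (i : Fin T.gluing.n) (k : Fin 4) :
    (TopCat.toSSet.obj (TopCat.of M)).obj (Opposite.op (SimplexCategory.mk 1)) :=
  (TopCat.toSSetObjEquiv (TopCat.of M) (Opposite.op (SimplexCategory.mk 1))).symm (T.dualPath i k)

end IdealTriangulation

end DualEdges

/-- The singular chain complex of a space with coefficients in `ℤ`. -/
noncomputable abbrev singularChains (M : Type) [TopologicalSpace M] :
    ChainComplex (ModuleCat.{0} ℤ) ℕ :=
  ((AlgebraicTopology.singularChainComplexFunctor (ModuleCat.{0} ℤ)).obj (ModuleCat.of ℤ ℤ)).obj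
    (TopCat.of M)

/-- The singular homology group `H₁(M; A)`. -/
noncomputable abbrev H1 (A : Type) [AddCommGroup A] (M : Type) [TopologicalSpace M] :
    ModuleCat.{0} ℤ :=
  ((AlgebraicTopology.singularHomologyFunctor (ModuleCat.{0} ℤ) 1).obj (ModuleCat.of ℤ A)).obj
    (TopCat.of M)

/-- The reduction `H₁(M; ℤ) → H₁(M; ℤ/2)` induced by the coefficient map `ℤ → ℤ/2`. -/
noncomputable def reduceModTwo (M : Type) [TopologicalSpace M] : H1 ℤ M ⟶ H1 (ZMod 2) M :=
  ((AlgebraicTopology.singularHomologyFunctor (ModuleCat.{0} ℤ) 1).map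
    (ModuleCat.ofHom (Int.castAddHom (ZMod 2)).toIntLinearMap)).app (TopCat.of M)

namespace IdealTriangulation

open CategoryTheory AlgebraicTopology

variable {M : Type} [TopologicalSpace M] [ChartedSpace (EuclideanHalfSpace 3) M]
  [IsManifold (𝓡∂ 3) ∞ M] (T : IdealTriangulation M)

/-- The singular `1`-chain `dualSimplex i k`. A chain with integral coefficients is given as a
morphism from `ℤ`, that is by the image of `1`. -/
noncomputable def dualEdgeChain (i : Fin T.gluing.n) (k : Fin 4) :
    ModuleCat.of ℤ ℤ ⟶ (singularChains M).X 1 :=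
  (TopCat.toSSet.obj (TopCat.of M)).ιChainComplex (R := ModuleCat.of ℤ ℤ) (T.dualSimplex i k)

/-- The fundamental `1`-cycle of a pre-branching, as a singular chain: each dual edge is the union
of its two halves, both run through in the direction given by `w`. -/
noncomputable def preBranchingChain (w : T.gluing.PreBranching) :
    ModuleCat.of ℤ ℤ ⟶ (singularChains M).X 1 :=
  ∑ i : Fin T.gluing.n, ∑ k : Fin 4, (if w.out i k then (1 : ℤ) else -1) • T.dualEdgeChain i k

/-- The `0`-chain given by the endpoint `j` of the path `dualSimplex i k`. -/
noncomputable def dualEnd (i : Fin T.gluing.n) (k : Fin 4) (j : Fin 2) :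
    ModuleCat.of ℤ ℤ ⟶ (singularChains M).X 0 :=
  (TopCat.toSSet.obj (TopCat.of M)).ιChainComplex (R := ModuleCat.of ℤ ℤ) (n := 0)
    ((TopCat.toSSet.obj (TopCat.of M)).δ j (T.dualSimplex i k))

lemma dualEdgeChain_d (i : Fin T.gluing.n) (k : Fin 4) :
    T.dualEdgeChain i k ≫ (singularChains M).d 1 0 = T.dualEnd i k 0 - T.dualEnd i k 1 := by
  have := (TopCat.toSSet.obj (TopCat.of M)).ιChainComplex_d (ModuleCat.of ℤ ℤ) (n := 0)
    (T.dualSimplex i k)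
  refine this.trans ?_
  rw [Fin.sum_univ_two]
  simp only [Fin.val_zero, Fin.val_one, pow_zero, pow_one, one_smul, neg_smul, sub_eq_add_neg]
  rfl

lemma dualEnd_congr {i i' : Fin T.gluing.n} {k k' : Fin 4} {j : Fin 2}
    (h : ∀ z : stdSimplex ℝ (Fin 1),
      T.gluing.point i (halfDualEdge k (stdSimplex.map j.succAbove z)) =
        T.gluing.point i' (halfDualEdge k' (stdSimplex.map j.succAbove z))) :
    T.dualEnd i k j = T.dualEnd i' k' j := by
  unfold dualEnd
  congr 1
  apply (TopCat.toSSetObjEquiv (TopCat.of M) _).injective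
  ext z
  rw [TopCat.toSSetObjEquiv_δ_apply, TopCat.toSSetObjEquiv_δ_apply]
  simp only [dualSimplex, Equiv.apply_symm_apply]
  simp only [dualPath, ContinuousMap.coe_mk]
  congr 3
  exact congrArg T.homeo (h z)

lemma dualEnd_one (i : Fin T.gluing.n) (k : Fin 4) : T.dualEnd i k 1 = T.dualEnd i 0 1 := by
  refine T.dualEnd_congr fun z => ?_
  congr 1
  refine Subtype.ext (funext fun v => ?_)
  have : (stdSimplex.map (Fin.succAbove 1) z : stdSimplex ℝ (Fin 2)).1 1 = 0 := by
    change (stdSimplex.map (Fin.succAbove 1) z : stdSimplex ℝ (Fin 2)) 1 = 0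
    simp [stdSimplex.map_coe, FunOnFinite.linearMap_apply_apply]
  simp [halfDualEdge, this]

lemma dualEnd_zero (i : Fin T.gluing.n) (k : Fin 4) :
    T.dualEnd (T.gluing.nbr i k) (T.gluing.perm i k k) 0 = T.dualEnd i k 0 := by
  refine T.dualEnd_congr fun z => ?_
  have hz : (stdSimplex.map (Fin.succAbove 0) z : stdSimplex ℝ (Fin 2)).1 0 = 0 := by
    change (stdSimplex.map (Fin.succAbove 0) z : stdSimplex ℝ (Fin 2)) 0 = 0
    rw [stdSimplex.map_coe, FunOnFinite.linearMap_apply_apply]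
    simp
  have h := Quot.sound (TetGluing.Rel.glue (G := T.gluing) i k
    (halfDualEdge k (stdSimplex.map (Fin.succAbove 0) z)) (by
      change (halfDualEdge k _).1 k = 0
      simp only [halfDualEdge, hz]
      simp))
  refine Eq.trans ?_ h.symm
  change Quot.mk _ _ = Quot.mk _ _
  congr 2
  refine Subtype.ext (funext fun v => ?_)
  obtain ⟨v, rfl⟩ := (T.gluing.perm i k).surjective v
  refine Eq.trans ?_ (TetGluing.map_perm_apply _ _ _).symm
  change (halfDualEdge _ _).1 _ = (halfDualEdge _ _).1 _
  simp only [halfDualEdge, hz]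
  simp

lemma preBranchingChain_d (w : T.gluing.PreBranching) :
    T.preBranchingChain w ≫ (singularChains M).d 1 0 = 0 := by
  have hA : ∀ i, ∑ k : Fin 4, (if w.out i k then (1 : ℤ) else -1) = 0 := by
    intro i
    have := w.two_out i
    generalize w.out i = f at this
    revert f
    decide
  have hF : ∑ i, ∑ k, (if w.out i k then (1 : ℤ) else -1) • T.dualEnd i k 0 = 0 := by
    rw [← Finset.sum_product' Finset.univ Finset.univ]
    refine Finset.sum_involution
      (fun a _ => (T.gluing.nbr a.1 a.2, T.gluing.perm a.1 a.2 a.2)) ?_ ?_ ?_ ?_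
    · rintro ⟨i, k⟩ -
      simp only [w.glue, dualEnd_zero]
      cases w.out i k <;> simp
    · rintro ⟨i, k⟩ - -
      exact T.gluing.no_fixed_face i k
    · simp
    · rintro ⟨i, k⟩ -
      have : (T.gluing.perm i k)⁻¹ (T.gluing.perm i k k) = k := Equiv.symm_apply_apply _ _
      simp only [T.gluing.nbr_nbr, T.gluing.perm_perm, this]
  simp only [preBranchingChain, Preadditive.sum_comp, Preadditive.zsmul_comp, dualEdgeChain_d,
    smul_sub, Finset.sum_sub_distrib, hF, zero_sub, neg_eq_zero]
  refine Finset.sum_eq_zero fun i _ => ?_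
  rw [Finset.sum_congr rfl (fun k _ => by rw [T.dualEnd_one i k]), ← Finset.sum_smul, hA, zero_smul]

/-- The class `[w] ∈ H₁(M; ℤ)` of a pre-branching. -/
noncomputable def preBranchingClass (w : T.gluing.PreBranching) : H1 ℤ M :=
  ((singularChains M).liftCycles (T.preBranchingChain w) 0 (by simp) (T.preBranchingChain_d w) ≫
    (singularChains M).homologyπ 1).hom (1 : ℤ)

end IdealTriangulation

/-! ## Ideal pre-branched transits -/

namespace TetGluing

/-- A relabelling of gluings: a bijection of the tetrahedra and, for each tetrahedron, a bijection
of its vertices, compatible with the face gluings. -/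
structure Relabelling (G G' : TetGluing) where
  e : Fin G.n ≃ Fin G'.n
  r : Fin G.n → Equiv.Perm (Fin 4)
  nbr_eq : ∀ i k, G'.nbr (e i) (r i k) = e (G.nbr i k)
  perm_eq : ∀ i k, G'.perm (e i) (r i k) = r (G.nbr i k) * G.perm i k * (r i)⁻¹

/-- The choices in a `2 → 3` move from `G` to `G'`. The two distinct tetrahedra are `τ` and its
neighbour `τ₂` through the face `t` of `τ` opposite to `p 3`. With `q` the labelling of `τ₂`
obtained from `p` through the gluing along `t`, the vertices of `t` are `p j = q j` for `j < 3`,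
and the vertices opposite to `t` are `p 3` in `τ` and `q 3` in `τ₂`. The map `e` identifies the
tetrahedra of `G'` with the persistent ones of `G` together with three new tetrahedra. -/
structure TwoThreeData (G G' : TetGluing) where
  τ : Fin G.n
  p : Equiv.Perm (Fin 4)
  ne : G.nbr τ (p 3) ≠ τ
  e : {i : Fin G.n // i ≠ τ ∧ i ≠ G.nbr τ (p 3)} ⊕ Fin 3 ≃ Fin G'.n

namespace TwoThreeData

variable {G G' : TetGluing} (D : TwoThreeData G G')

/-- The second tetrahedron. -/
def τ₂ : Fin G.n := G.nbr D.τ (D.p 3)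

/-- The labelling of the vertices of the second tetrahedron. -/
def q : Equiv.Perm (Fin 4) := G.perm D.τ (D.p 3) * D.p

/-- The `j`-th new tetrahedron. It has the new edge from `p 3` to `q 3` and the two vertices of `t`
other than the `j`-th one. In it, `p 3` has label `3`, `q 3` has label `j` and the vertices of `t`
keep their labels. -/
def new (j : Fin 3) : Fin G'.n := D.e (Sum.inr j)

/-- `D.Side i k i' r`: the side in `i` of the persistent face of `G` opposite to `k` becomes in `G'`
the side in `i'` of the face opposite to `r k`, each vertex `v ≠ k` of `i` becoming the vertex `r v`
of `i'`. -/
inductive Side : Fin G.n → Fin 4 → Fin G'.n → Equiv.Perm (Fin 4) → Prop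
  | kept (i : {i : Fin G.n // i ≠ D.τ ∧ i ≠ G.nbr D.τ (D.p 3)}) (k : Fin 4) :
      Side i.1 k (D.e (Sum.inl i)) 1
  | first (j : Fin 3) : Side D.τ (D.p j.castSucc) (D.new j) D.p⁻¹
  | second (j : Fin 3) :
      Side D.τ₂ (D.q j.castSucc) (D.new j) (Equiv.swap j.castSucc 3 * D.q⁻¹)

/-- `G'` is obtained from `G` by the `2 → 3` move with the choices `D`: the persistent faces are
glued as before, and the three new tetrahedra are glued cyclically around the new edge. -/
structure IsMove : Prop where
  side_glue : ∀ i k i' r, D.Side i k i' r →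
    ∀ j' r', D.Side (G.nbr i k) (G.perm i k k) j' r' →
      G'.nbr i' (r k) = j' ∧ G'.perm i' (r k) = r' * G.perm i k * r⁻¹
  new_glue : ∀ j l : Fin 3, j ≠ l →
    G'.nbr (D.new j) l.castSucc = D.new l ∧
      G'.perm (D.new j) l.castSucc = Equiv.swap j.castSucc l.castSucc

end TwoThreeData

/-- Position in the bipyramid `τ ∪ τ₂`, on the side of `τ`, of the point with coordinates `x` in the
`j`-th new tetrahedron when `x j ≤ x 3`. The new edge meets the triangle `t` at its barycenter,
so that `p 3 + q 3 = (2/3) (p 0 + p 1 + p 2)`; the coordinates are those with respect to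
`p 0, p 1, p 2, p 3`. -/
noncomputable def bipyramidCoord (j : Fin 3) (x : Fin 4 → ℝ) (v : Fin 4) : ℝ :=
  if v = 3 then x 3 - x j.castSucc
  else if v = j.castSucc then (2 / 3) * x j.castSucc
  else x v + (2 / 3) * x j.castSucc

/-- One step around an edge. The pair `(i, p)` stands for the edge from `p 0` to `p 1` in the
tetrahedron `i`, which is entered through the face opposite to `p 3` and left through the face
opposite to `p 2`. -/
def turn (G : TetGluing) (a : Fin G.n × Equiv.Perm (Fin 4)) : Fin G.n × Equiv.Perm (Fin 4) :=
  (G.nbr a.1 (a.2 2), G.perm a.1 (a.2 2) * a.2 * Equiv.swap 2 3)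

/-- The choices in a quadrilateral `0 → 2` move from `G` to `G'`. The quadrilateral is made by two
distinct triangles `t₁` and `t₂` with a common edge; `t₁` is the face opposite to `start.2 3`
of `start.1`, and turning `steps` times around its edge from `start.2 0` to `start.2 1` one arrives
at a tetrahedron whose exit face is `t₂`. The map `e` identifies the tetrahedra of `G'` with those
of `G` together with two new ones. -/
structure QuadData (G G' : TetGluing) where
  start : Fin G.n × Equiv.Perm (Fin 4)
  steps : ℕ
  ne : ((G.turn^[steps] start).1, (G.turn^[steps] start).2 2) ≠ (start.1, start.2 3)
  ne' : ((G.turn^[steps] start).1, (G.turn^[steps] start).2 2) ≠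
    (G.nbr start.1 (start.2 3), G.perm start.1 (start.2 3) (start.2 3))
  e : Fin G.n ⊕ Fin 2 ≃ Fin G'.n

namespace QuadData

variable {G G' : TetGluing} (D : QuadData G G')

/-- The last tetrahedron met when turning from `t₁` to `t₂`, with its labelling. -/
def last : Fin G.n × Equiv.Perm (Fin 4) := G.turn^[D.steps] D.start

/-- The tetrahedron `i` of `G` as a tetrahedron of `G'`. -/
def old (i : Fin G.n) : Fin G'.n := D.e (Sum.inl i)

/-- The two tetrahedra of the pillow. In both, the labels `0, 1` are the endpoints of the common
edge of `t₁` and `t₂`, the label `2` is the vertex of `t₁` opposite to it, and the label `3` the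
vertex of `t₂` opposite to it. -/
def new (s : Fin 2) : Fin G'.n := D.e (Sum.inr s)

/-- The side in `i` of the face opposite to `k` is one of the four sides of `t₁` and `t₂`. -/
def IsCutSide (i : Fin G.n) (k : Fin 4) : Prop :=
  (i, k) = (D.start.1, D.start.2 3) ∨
  (i, k) = (G.nbr D.start.1 (D.start.2 3), G.perm D.start.1 (D.start.2 3) (D.start.2 3)) ∨
  (i, k) = (D.last.1, D.last.2 2) ∨
  (i, k) = (G.nbr D.last.1 (D.last.2 2), G.perm D.last.1 (D.last.2 2) (D.last.2 2))

/-- `G'` is obtained from `G` by the quadrilateral `0 → 2` move with the choices `D`: `G` is cut open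
along `t₁ ∪ t₂`, and the pillow made by two tetrahedra, glued to each other along the two faces
which contain the other diagonal of the quadrilateral, is inserted. -/
structure IsMove : Prop where
  old_glue : ∀ i k, ¬ D.IsCutSide i k →
    G'.nbr (D.old i) k = D.old (G.nbr i k) ∧ G'.perm (D.old i) k = G.perm i k
  new_glue : ∀ k : Fin 4, k = 0 ∨ k = 1 →
    G'.nbr (D.new 0) k = D.new 1 ∧ G'.perm (D.new 0) k = 1
  first_front : G'.nbr (D.new 0) 3 = D.old D.start.1 ∧ G'.perm (D.new 0) 3 = D.start.2
  second_front : G'.nbr (D.new 0) 2 = D.old D.last.1 ∧ G'.perm (D.new 0) 2 = D.last.2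
  first_back : G'.nbr (D.new 1) 3 = D.old (G.nbr D.start.1 (D.start.2 3)) ∧
    G'.perm (D.new 1) 3 = G.perm D.start.1 (D.start.2 3) * D.start.2
  second_back : G'.nbr (D.new 1) 2 = D.old (G.nbr D.last.1 (D.last.2 2)) ∧
    G'.perm (D.new 1) 2 = G.perm D.last.1 (D.last.2 2) * D.last.2

end QuadData

/-- The projection of a pillow tetrahedron to the flat quadrilateral, whose two diagonals `01` and
`23` meet at their midpoints: when `x 3 ≤ x 2`, the image of the point with coordinates `x` lies
in the triangle with vertices `0, 1, 2` and has these coordinates; when `x 2 ≤ x 3`, it lies in the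
triangle with vertices `0, 1, 3`. -/
noncomputable def pillowCoord (x : Fin 4 → ℝ) : Fin 4 → ℝ :=
  ![x 0 + min (x 2) (x 3), x 1 + min (x 2) (x 3), x 2 - min (x 2) (x 3), x 3 - min (x 2) (x 3)]

end TetGluing

namespace IdealTriangulation

variable {M : Type} [TopologicalSpace M] [ChartedSpace (EuclideanHalfSpace 3) M]

/-- The identification of the realization with `M̂` can be deformed to the map `f` through
homeomorphisms which are constant on the vertices, `f` itself being allowed not to be one.
If `f` is a homeomorphism, this is an isotopy relative to `V`. -/
def DeformsTo (T : IdealTriangulation M) (f : T.gluing.Space → CollapsedManifold M) : Prop :=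
  ∃ H : C(unitInterval × T.gluing.Space, CollapsedManifold M),
    (∀ a, H (0, a) = T.homeo a) ∧ (∀ a, H (1, a) = f a) ∧
    (∀ s : unitInterval, s < 1 →
      ∃ g : T.gluing.Space ≃ₜ CollapsedManifold M, ∀ a, H (s, a) = g a) ∧
    ∀ s a, T.gluing.IsVertex a → H (s, a) = T.homeo a

end IdealTriangulation

/-- A pre-branched ideal triangulation `(T, w)` of `M̂`. -/
structure PreBranchedTriangulation (M : Type) [TopologicalSpace M]
    [ChartedSpace (EuclideanHalfSpace 3) M] where
  T : IdealTriangulation M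
  w : T.gluing.PreBranching

namespace PreBranchedTriangulation

open TetGluing

variable {M : Type} [TopologicalSpace M] [ChartedSpace (EuclideanHalfSpace 3) M]

/-- The same pre-branched triangulation up to relabelling and isotopy of `M̂` which keeps `V`
pointwise fixed. -/
def Isotopic (P P' : PreBranchedTriangulation M) : Prop :=
  ∃ R : Relabelling P.T.gluing P'.T.gluing,
    (∃ f, P'.T.DeformsTo f ∧ ∀ i x,
      f (P'.T.gluing.point (R.e i) (stdSimplex.map (R.r i) x)) =
        P.T.homeo (P.T.gluing.point i x)) ∧
    ∀ i k, P'.w.out (R.e i) (R.r i k) = P.w.out i k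

/-- A positive `2 → 3` transit: the triangulations coincide outside the two tetrahedra, which are
replaced by three tetrahedra with the same union, and the pre-branchings agree on the persistent
faces. -/
def TwoThree (P P' : PreBranchedTriangulation M) : Prop :=
  ∃ D : TwoThreeData P.T.gluing P'.T.gluing, D.IsMove ∧
    (∀ i x, P'.T.homeo (P'.T.gluing.point (D.e (Sum.inl i)) x) =
      P.T.homeo (P.T.gluing.point i.1 x)) ∧
    (∀ (j : Fin 3) (x y : Tetra), x.1 j.castSucc ≤ x.1 3 →
      (∀ v, y.1 (D.p v) = bipyramidCoord j x.1 v) →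
      P'.T.homeo (P'.T.gluing.point (D.new j) x) = P.T.homeo (P.T.gluing.point D.τ y)) ∧
    (∀ (j : Fin 3) (x y : Tetra), x.1 3 ≤ x.1 j.castSucc →
      (∀ v, y.1 (D.q v) = bipyramidCoord j (x.1 ∘ Equiv.swap j.castSucc 3) v) →
      P'.T.homeo (P'.T.gluing.point (D.new j) x) = P.T.homeo (P.T.gluing.point D.τ₂ y)) ∧
    ∀ i k i' r, D.Side i k i' r → P'.w.out i' (r k) = P.w.out i k

/-- A positive quadrilateral `0 → 2` transit: the quadrilateral is replaced by a pillow (so that the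
new triangulation shrinks back to the old one by flattening the pillow), and the pre-branchings agree
on the persistent tetrahedra; in particular the transverse orientations of the pillow boundary are
two copies of those of the quadrilateral. -/
def Quad (P P' : PreBranchedTriangulation M) : Prop :=
  ∃ D : QuadData P.T.gluing P'.T.gluing, D.IsMove ∧
    (∃ f, P'.T.DeformsTo f ∧
      (∀ i x, f (P'.T.gluing.point (D.old i) x) = P.T.homeo (P.T.gluing.point i x)) ∧
      (∀ (s : Fin 2) (x y : Tetra), x.1 3 ≤ x.1 2 →
        (∀ v, y.1 (D.start.2 v) = pillowCoord x.1 v) →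
        f (P'.T.gluing.point (D.new s) x) = P.T.homeo (P.T.gluing.point D.start.1 y)) ∧
      (∀ (s : Fin 2) (x y : Tetra), x.1 2 ≤ x.1 3 →
        (∀ v, y.1 (D.last.2 v) = pillowCoord x.1 v) →
        f (P'.T.gluing.point (D.new s) x) = P.T.homeo (P.T.gluing.point D.last.1 y))) ∧
    ∀ i k, P'.w.out (D.old i) k = P.w.out i k

/-- The ideal `pb`-transit equivalence: it is generated by isotopy, the `2 ↔ 3` transits and the
quadrilateral `0 ↔ 2` transits. -/
def IdealTransitEquiv : PreBranchedTriangulation M → PreBranchedTriangulation M → Prop :=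
  Relation.EqvGen fun P P' => P.Isotopic P' ∨ P.TwoThree P' ∨ P.Quad P'

/-- The class `[w] ∈ H₁(M; ℤ)`. -/
noncomputable def homologyClass [IsManifold (𝓡∂ 3) ∞ M] (P : PreBranchedTriangulation M) :
    H1 ℤ M :=
  P.T.preBranchingClass P.w

end PreBranchedTriangulation

/-! ## One-chains modulo boundaries -/

/-! Homology classes are compared in `C₁/B₁`, into which `H₁` embeds by `homologyι`. There even an
open path has a class, and concatenation of affine segments inside a convex set is addition
(`segClass_add`). Each claim becomes bookkeeping with halves of dual edges, running from the
barycenter of a tetrahedron to that of one of its faces.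

Evenness: the regions of the spine are discs, so orient each of them arbitrarily; the boundary of
their sum is null-homologous (`chainClass_regionBoundary`). Three region corners meet along each
edge of the spine, so this boundary has odd coefficients, and so has `ω`, whose coefficients are
`±1`. The difference is twice a chain, and that chain is again a cycle because `ℤ` has no 2-torsion
(`PreBranching.exists_coeff_eq`). This is (3), and (2) follows because reduction mod 2 kills
doubles. For `ω = ω_b`, orient the regions by the branching: the three signs along an edge are never
all equal, so their sum is exactly the prevailing sign, and `ω_b` is itself the boundary
(`Branching.exists_coeff_eq`). This is (4).

Invariance under isotopy is the prism argument (`chainClass_eq_of_homotopy`). It needs no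
injectivity at the end of the deformation, so it also covers the flattening of a pillow, after which
the two new tetrahedra have the same halves with opposite coefficients. For a `2 → 3` move, each
half in a new tetrahedron lies inside one old tetrahedron, where it is a difference of values of a
potential; before and after the move only the values at the six outer faces survive. -/

section SegmentClasses

open CategoryTheory

/-- Singular `1`-chains modulo boundaries. A class is given as a morphism from `ℤ`. -/
noncomputable abbrev ChainClass (M : Type) [TopologicalSpace M] : Type :=
  ModuleCat.of ℤ ℤ ⟶ (singularChains M).opcycles 1

variable {M : Type} [TopologicalSpace M]

/-- The chain given by a singular simplex. -/
noncomputable def simplexChain {m : ℕ} (σ : C(stdSimplex ℝ (Fin (m + 1)), M)) :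
    ModuleCat.of ℤ ℤ ⟶ (singularChains M).X m :=
  (TopCat.toSSet.obj (TopCat.of M)).ιChainComplex (R := ModuleCat.of ℤ ℤ)
    ((TopCat.toSSetObjEquiv (TopCat.of M) (Opposite.op (SimplexCategory.mk m))).symm σ)

/-- A face of a singular simplex. -/
noncomputable def simplexFace {m : ℕ} (σ : C(stdSimplex ℝ (Fin (m + 2)), M)) (j : Fin (m + 2)) :
    C(stdSimplex ℝ (Fin (m + 1)), M) :=
  σ.comp ⟨stdSimplex.map j.succAbove, stdSimplex.continuous_map _⟩

lemma simplexChain_d {m : ℕ} (σ : C(stdSimplex ℝ (Fin (m + 2)), M)) :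
    simplexChain σ ≫ (singularChains M).d (m + 1) m =
      ∑ j : Fin (m + 2), (-1) ^ (j : ℕ) • simplexChain (simplexFace σ j) :=
  (TopCat.toSSet.obj (TopCat.of M)).ιChainComplex_d (ModuleCat.of ℤ ℤ) (n := m) _

/-- The class of a singular `1`-simplex modulo boundaries. -/
noncomputable def pathClass (σ : C(stdSimplex ℝ (Fin 2), M)) : ChainClass M :=
  simplexChain σ ≫ (singularChains M).pOpcycles 1

/-- The boundary of `σ` dies modulo boundaries. This is the only relation among paths that the whole
argument uses. -/
lemma pathClass_triangle (σ : C(stdSimplex ℝ (Fin 3), M)) :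
    pathClass (simplexFace σ 2) + pathClass (simplexFace σ 0) = pathClass (simplexFace σ 1) := by
  have h := simplexChain_d σ
  rw [Fin.sum_univ_three] at h
  replace h := congrArg (· ≫ (singularChains M).pOpcycles 1) h
  simp only [Category.assoc, HomologicalComplex.d_pOpcycles, Limits.comp_zero,
    Preadditive.add_comp, Fin.val_zero, pow_zero, one_smul, Fin.val_one, pow_one, Fin.val_two,
    neg_smul, Preadditive.neg_comp, neg_one_sq] at h
  change 0 = pathClass (simplexFace σ 0) + -pathClass (simplexFace σ 1)
    + pathClass (simplexFace σ 2) at h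
  rw [← sub_eq_zero, h]
  abel

/-! ### Affine segments in convex sets -/

variable {E : Type} [AddCommGroup E] [Module ℝ E] [TopologicalSpace E] [IsTopologicalAddGroup E]
  [ContinuousSMul ℝ E] {K : Set E}

/-- The affine simplex in a convex set with given vertices. -/
def affineSimplex (hK : Convex ℝ K) {m : ℕ} (v : Fin m → K) : C(stdSimplex ℝ (Fin m), K) where
  toFun u := ⟨∑ j, u.1 j • (v j : E),
    hK.sum_mem (fun j _ => u.2.1 j) u.2.2 fun j _ => (v j).2⟩
  continuous_toFun := Continuous.subtype_mk (continuous_finsetSum _ fun j _ =>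
    ((continuous_apply j).comp continuous_subtype_val).smul continuous_const) _

lemma affineSimplex_map (hK : Convex ℝ K) {m l : ℕ} (v : Fin m → K) (g : Fin l → Fin m)
    (u : stdSimplex ℝ (Fin l)) :
    affineSimplex hK v (stdSimplex.map g u) = affineSimplex hK (v ∘ g) u := by
  apply Subtype.ext
  change ∑ j, (stdSimplex.map g u) j • (v j : E) = ∑ j, u.1 j • (v (g j) : E)
  simp only [stdSimplex.map_coe, FunOnFinite.linearMap_apply_apply, Finset.sum_smul]
  rw [← Finset.sum_fiberwise Finset.univ g fun j => u.1 j • (v (g j) : E)]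
  refine Finset.sum_congr rfl fun j _ => Finset.sum_congr rfl fun l hl => ?_
  rw [(Finset.mem_filter.1 hl).2]
  rfl

/-- The class modulo boundaries of the image of an affine segment in a convex set. -/
noncomputable def segClass (hK : Convex ℝ K) (φ : C(K, M)) (x y : K) : ChainClass M :=
  pathClass (φ.comp (affineSimplex hK ![x, y]))

lemma segClass_add (hK : Convex ℝ K) (φ : C(K, M)) (x y z : K) :
    segClass hK φ x y + segClass hK φ y z = segClass hK φ x z := by
  have key : ∀ (j : Fin 3) (a b : K), ![x, y, z] ∘ j.succAbove = ![a, b] →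
      simplexFace (φ.comp (affineSimplex hK ![x, y, z])) j =
        φ.comp (affineSimplex hK ![a, b]) := by
    intro j a b h
    ext u
    rw [← h]
    exact congrArg φ (affineSimplex_map hK _ _ u)
  have := pathClass_triangle (φ.comp (affineSimplex hK ![x, y, z]))
  rw [key 2 x y (by ext j; fin_cases j <;> rfl), key 0 y z (by ext j; fin_cases j <;> rfl),
    key 1 x z (by ext j; fin_cases j <;> rfl)] at this
  exact this

lemma segClass_self (hK : Convex ℝ K) (φ : C(K, M)) (x : K) : segClass hK φ x x = 0 := by
  simpa using segClass_add hK φ x x x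

/-- The point of the segment from `x` to `y` with given coordinates. -/
def segPoint (hK : Convex ℝ K) (x y : K) (u : stdSimplex ℝ (Fin 2)) : K :=
  ⟨u.1 0 • (x : E) + u.1 1 • (y : E), hK x.2 y.2 (u.2.1 0) (u.2.1 1) (by
    rw [← u.2.2, Fin.sum_univ_two])⟩

lemma affineSimplex_pair (hK : Convex ℝ K) (x y : K) (u : stdSimplex ℝ (Fin 2)) :
    affineSimplex hK ![x, y] u = segPoint hK x y u :=
  Subtype.ext (Fin.sum_univ_two fun j => u.1 j • ((![x, y] : Fin 2 → K) j : E))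

lemma segClass_eq_pathClass (hK : Convex ℝ K) (φ : C(K, M)) (x y : K)
    (σ : C(stdSimplex ℝ (Fin 2), M)) (h : ∀ u, φ (segPoint hK x y u) = σ u) :
    segClass hK φ x y = pathClass σ := by
  unfold segClass
  congr 1
  ext u
  rw [ContinuousMap.comp_apply, affineSimplex_pair, h]

/-- The class depends only on the parametrized path in `M`. This is how segments pass from one side
of a gluing to the other and from one triangulation to another. -/
lemma segClass_congr {E' : Type} [AddCommGroup E'] [Module ℝ E'] [TopologicalSpace E']
    [IsTopologicalAddGroup E'] [ContinuousSMul ℝ E'] {K' : Set E'} (hK : Convex ℝ K)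
    (hK' : Convex ℝ K') (φ : C(K, M)) (φ' : C(K', M)) (x y : K) (x' y' : K')
    (h : ∀ u, φ (segPoint hK x y u) = φ' (segPoint hK' x' y' u)) :
    segClass hK φ x y = segClass hK' φ' x' y' := by
  refine segClass_eq_pathClass hK φ x y _ fun u => ?_
  rw [h, ContinuousMap.comp_apply, affineSimplex_pair]

end SegmentClasses

/-! ## Cellular chains of the dual spine -/

section DualChains

/-- The standard tetrahedron without its vertices. -/
def openTetra : Set (Fin 4 → ℝ) := {x | x ∈ stdSimplex ℝ (Fin 4) ∧ ∀ v, x v ≠ 1}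

/-- Vertices are extreme points of the simplex. Convexity matters because segments can be added only
in convex sets, while only points off the vertices are known to lift to `M`. -/
lemma convex_openTetra : Convex ℝ openTetra := by
  intro x hx y hy a b ha hb hab
  refine ⟨convex_stdSimplex ℝ _ hx.1 hy.1 ha hb hab, fun v => ne_of_lt ?_⟩
  have hxv := lt_of_le_of_ne (mem_Icc_of_mem_stdSimplex hx.1 v).2 (hx.2 v)
  have hyv := lt_of_le_of_ne (mem_Icc_of_mem_stdSimplex hy.1 v).2 (hy.2 v)
  change a * x v + b * y v < 1
  rcases ha.eq_or_lt with rfl | ha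
  · obtain rfl : b = 1 := by linarith
    linarith
  · nlinarith

namespace openTetra

/-- A point of the tetrahedron which is not a vertex, as a point of the closed tetrahedron. -/
def toTetra (x : openTetra) : Tetra := ⟨x.1, x.2.1⟩

lemma continuous_toTetra : Continuous toTetra :=
  Continuous.subtype_mk continuous_subtype_val _

lemma nonneg (x : openTetra) (v : Fin 4) : 0 ≤ x.1 v := x.2.1.1 v

lemma sum_eq_one (x : openTetra) : x.1 0 + x.1 1 + x.1 2 + x.1 3 = 1 := by
  rw [← x.2.1.2, Fin.sum_univ_four]

/-- Permutation of the vertices. -/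
def relabel (g : Equiv.Perm (Fin 4)) (x : openTetra) : openTetra :=
  ⟨x.1 ∘ g.symm, ⟨fun _ => x.2.1.1 _, (Equiv.sum_comp g.symm x.1).trans x.2.1.2⟩,
    fun _ => x.2.2 _⟩

lemma toTetra_relabel (g : Equiv.Perm (Fin 4)) (x : openTetra) :
    toTetra (relabel g x) = stdSimplex.map g (toTetra x) := by
  refine Subtype.ext (funext fun v => ?_)
  obtain ⟨v, rfl⟩ := g.surjective v
  refine Eq.trans ?_ (TetGluing.map_perm_apply g (toTetra x) v).symm
  change x.1 (g.symm (g v)) = x.1 v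
  rw [Equiv.symm_apply_apply]

lemma segPoint_relabel (g : Equiv.Perm (Fin 4)) (x y : openTetra) (u : stdSimplex ℝ (Fin 2)) :
    segPoint convex_openTetra (relabel g x) (relabel g y) u =
      relabel g (segPoint convex_openTetra x y u) := rfl

/-- The barycenter of the tetrahedron. -/
noncomputable def bary : openTetra :=
  ⟨fun _ => 1 / 4, ⟨fun _ => by norm_num, by norm_num⟩, fun _ => by norm_num⟩

/-- The barycenter of the intersection of the faces opposite to `k` and to `l`: the midpoint of an
edge if `k ≠ l`, the barycenter of a face if `k = l`. -/
noncomputable def faceBary (k l : Fin 4) : openTetra :=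
  ⟨fun v => if v = k ∨ v = l then 0 else if k = l then 1 / 3 else 1 / 2,
    ⟨fun v => by dsimp only; split_ifs <;> norm_num, by
      rw [Fin.sum_univ_four]
      fin_cases k <;> fin_cases l <;> simp <;> norm_num⟩,
    fun v => by dsimp only; split_ifs <;> norm_num⟩

lemma faceBary_comm (k l : Fin 4) : faceBary k l = faceBary l k := by
  simp only [faceBary, or_comm, eq_comm (a := k)]

lemma relabel_faceBary (g : Equiv.Perm (Fin 4)) (k l : Fin 4) :
    relabel g (faceBary k l) = faceBary (g k) (g l) := by
  refine Subtype.ext (funext fun v => ?_)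
  change (if g.symm v = k ∨ g.symm v = l then (0 : ℝ) else if k = l then 1 / 3 else 1 / 2) =
    if v = g k ∨ v = g l then 0 else if g k = g l then 1 / 3 else 1 / 2
  simp only [Equiv.symm_apply_eq, EmbeddingLike.apply_eq_iff_eq]

lemma relabel_bary (g : Equiv.Perm (Fin 4)) : relabel g bary = bary := rfl

lemma faceBary_left (k l : Fin 4) : (faceBary k l).1 k = 0 := if_pos (Or.inl rfl)

lemma toTetra_segPoint_half (k : Fin 4) (u : stdSimplex ℝ (Fin 2)) :
    toTetra (segPoint convex_openTetra bary (faceBary k k) u) = halfDualEdge k u := by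
  refine Subtype.ext (funext fun v => ?_)
  change u.1 0 * (1 / 4) + u.1 1 * (if v = k ∨ v = k then 0 else if k = k then 1 / 3 else 1 / 2) =
    u.1 0 * (1 / 4) + u.1 1 * (if v = k then 0 else 1 / 3)
  simp

end openTetra

/-! ### Cycles of the dual spine and maps into the collapsed manifold -/

namespace TetGluing

open openTetra

/-- The chains which are cycles of the dual spine: `c i k` is the coefficient of the half of the
dual edge going from the tetrahedron `i` to its face opposite to `k`. -/
structure IsDualCycle (G : TetGluing) (c : Fin G.n → Fin 4 → ℤ) : Prop where
  glue : ∀ i k, c (G.nbr i k) (G.perm i k k) = -c i k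
  sum : ∀ i, ∑ k, c i k = 0

/-- Crossing a face is a fixed-point-free involution on the pairs (tetrahedron, face), so the terms
cancel in pairs. -/
lemma sum_eq_zero_of_glue {A : Type} [AddCommGroup A] (G : TetGluing) (f : Fin G.n → Fin 4 → A)
    (h : ∀ i k, f i k + f (G.nbr i k) (G.perm i k k) = 0) : ∑ i, ∑ k, f i k = 0 := by
  classical
  rw [← Finset.sum_product' Finset.univ Finset.univ]
  refine Finset.sum_involution
    (fun a _ => (G.nbr a.1 a.2, G.perm a.1 a.2 a.2)) ?_ ?_ ?_ ?_
  · rintro ⟨i, k⟩ -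
    exact h i k
  · rintro ⟨i, k⟩ - -
    exact G.no_fixed_face i k
  · simp
  · rintro ⟨i, k⟩ -
    have : (G.perm i k)⁻¹ (G.perm i k k) = k := Equiv.symm_apply_apply _ _
    simp only [G.nbr_nbr, G.perm_perm, this]

namespace PreBranching

variable {G : TetGluing}

/-- The chain of a pre-branching. -/
def coeff (w : G.PreBranching) (i : Fin G.n) (k : Fin 4) : ℤ := if w.out i k then 1 else -1

lemma isDualCycle_coeff (w : G.PreBranching) : G.IsDualCycle w.coeff where
  glue i k := by
    simp only [coeff, w.glue]
    cases w.out i k <;> simp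
  sum i := by
    have := w.two_out i
    simp only [coeff]
    generalize w.out i = f at this
    revert f
    decide

end PreBranching

/-- A map from the realization of a gluing to `M̂` sending only vertices into `V`. -/
structure IdealMap (G : TetGluing) (M : Type) [TopologicalSpace M]
    [ChartedSpace (EuclideanHalfSpace 3) M] where
  map : C(G.Space, CollapsedManifold M)
  avoids : ∀ p, ¬ G.IsVertex p → map p ∉ CollapsedManifold.marked M

lemma not_isVertex_point (G : TetGluing) (i : Fin G.n) (x : openTetra) :
    ¬ G.IsVertex (G.point i (toTetra x)) := fun ⟨v, hv⟩ => x.2.2 v hv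

lemma continuous_point (G : TetGluing) (i : Fin G.n) : Continuous (G.point i) :=
  continuous_quot_mk.comp (continuous_const.prodMk continuous_id)

lemma point_relabel (G : TetGluing) (i : Fin G.n) (k : Fin 4) (x : openTetra) (hx : x.1 k = 0) :
    G.point (G.nbr i k) (toTetra (relabel (G.perm i k) x)) = G.point i (toTetra x) := by
  rw [toTetra_relabel]
  exact (Quot.sound (Rel.glue i k (toTetra x) hx)).symm

end TetGluing

/-- The inclusion into `M` of the complement of the marked points. -/
noncomputable def CollapsedManifold.unmarkedToManifold (M : Type) [TopologicalSpace M]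
    [ChartedSpace (EuclideanHalfSpace 3) M] [IsManifold (𝓡∂ 3) ∞ M] :
    C({p : CollapsedManifold M // p ∉ marked M}, M) where
  toFun p := ((interiorHomeo M).symm p).1
  continuous_toFun := continuous_subtype_val.comp (interiorHomeo M).symm.continuous

/-! ### Segments and dual chains carried into the manifold -/

namespace TetGluing.IdealMap

open openTetra

variable {M : Type} [TopologicalSpace M] [ChartedSpace (EuclideanHalfSpace 3) M]
  [IsManifold (𝓡∂ 3) ∞ M] {G G' : TetGluing} (F : G.IdealMap M) (F' : G'.IdealMap M)

/-- The restriction of an ideal map to a tetrahedron without its vertices. -/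
noncomputable def cell (i : Fin G.n) : C(openTetra, M) :=
  (CollapsedManifold.unmarkedToManifold M).comp
    ⟨fun x => ⟨F.map (G.point i (toTetra x)), F.avoids _ (G.not_isVertex_point i x)⟩,
      Continuous.subtype_mk (F.map.continuous.comp
        ((G.continuous_point i).comp continuous_toTetra)) _⟩

lemma cell_congr {i : Fin G.n} {i' : Fin G'.n} {x x' : openTetra}
    (h : F.map (G.point i (toTetra x)) = F'.map (G'.point i' (toTetra x'))) :
    F.cell i x = F'.cell i' x' :=
  congrArg (CollapsedManifold.unmarkedToManifold M) (Subtype.ext h)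

/-- The class of the segment from `x` to `y` in the tetrahedron `i`. -/
noncomputable def seg (i : Fin G.n) (x y : openTetra) : ChainClass M :=
  segClass convex_openTetra (F.cell i) x y

lemma seg_add (i : Fin G.n) (x y z : openTetra) : F.seg i x y + F.seg i y z = F.seg i x z :=
  segClass_add _ _ _ _ _

lemma seg_self (i : Fin G.n) (x : openTetra) : F.seg i x x = 0 := segClass_self _ _ _

lemma seg_congr {i : Fin G.n} {i' : Fin G'.n} {x y x' y' : openTetra}
    (h : ∀ u, F.map (G.point i (toTetra (segPoint convex_openTetra x y u))) =
      F'.map (G'.point i' (toTetra (segPoint convex_openTetra x' y' u)))) :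
    F.seg i x y = F'.seg i' x' y' :=
  segClass_congr _ _ _ _ _ _ _ _ fun u => F.cell_congr F' (h u)

/-- A segment with both ends on a face stays in that face, and the two sides of a gluing see the
same path. -/
lemma seg_glue (i : Fin G.n) (k : Fin 4) (x y : openTetra) (hx : x.1 k = 0) (hy : y.1 k = 0) :
    F.seg (G.nbr i k) (relabel (G.perm i k) x) (relabel (G.perm i k) y) = F.seg i x y := by
  refine F.seg_congr F fun u => ?_
  rw [segPoint_relabel, G.point_relabel]
  change u.1 0 * x.1 k + u.1 1 * y.1 k = 0
  simp [hx, hy]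

/-- The class of the half of a dual edge going from the barycenter of the tetrahedron `i` to that of
its face opposite to `k`. -/
noncomputable def half (i : Fin G.n) (k : Fin 4) : ChainClass M := F.seg i bary (faceBary k k)

/-- The class of a combination of halves of dual edges. -/
noncomputable def chainClass (c : Fin G.n → Fin 4 → ℤ) : ChainClass M :=
  ∑ i, ∑ k, c i k • F.half i k

lemma chainClass_add (c c' : Fin G.n → Fin 4 → ℤ) :
    F.chainClass (c + c') = F.chainClass c + F.chainClass c' := by
  simp [chainClass, add_smul, Finset.sum_add_distrib]

lemma chainClass_smul (a : ℤ) (c : Fin G.n → Fin 4 → ℤ) :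
    F.chainClass (a • c) = a • F.chainClass c := by
  simp [chainClass, mul_smul, Finset.smul_sum]

/-- The boundary of a combination of regions of the dual spine is homologous to zero: `e i k l` is
the coefficient in the boundary of the region dual to the edge opposite to `k` and `l`. -/
lemma chainClass_regionBoundary (e : Fin G.n → Fin 4 → Fin 4 → ℤ)
    (hswap : ∀ i k l, e i l k = -e i k l)
    (hglue : ∀ i k l, k ≠ l → e (G.nbr i k) (G.perm i k k) (G.perm i k l) = -e i k l) :
    F.chainClass (fun i k => ∑ l, e i k l) = 0 := by
  have hdiag : ∀ i k, e i k k = 0 := fun i k => by have := hswap i k k; omega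
  -- The region is coned off from the midpoint of its dual edge: each half becomes a difference of
  -- two spokes ending there.
  have hhalf : ∀ i k l, F.half i k =
      F.seg i bary (faceBary k l) - F.seg i (faceBary k k) (faceBary k l) := fun i k l => by
    rw [eq_sub_iff_add_eq]
    exact F.seg_add _ _ _ _
  -- The spoke from the barycenter of the tetrahedron is common to the halves towards `k` and `l`,
  -- which have opposite coefficients.
  have h1 : ∀ i, ∑ k, ∑ l, e i k l • F.seg i bary (faceBary k l) = 0 := fun i => by
    rw [← Finset.sum_product' Finset.univ Finset.univ]
    refine Finset.sum_involution (fun a _ => (a.2, a.1)) ?_ ?_ ?_ ?_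
    · rintro ⟨k, l⟩ -
      dsimp only
      rw [hswap, faceBary_comm l k, neg_smul, neg_add_cancel]
    · rintro ⟨k, l⟩ - hne heq
      obtain rfl : l = k := congrArg Prod.fst heq
      exact hne (by simp [hdiag])
    · simp
    · simp
  -- The spoke from a face barycenter lies in the face, so it is common to the two tetrahedra glued
  -- there.
  have h2 : ∑ i, ∑ k, ∑ l, e i k l • F.seg i (faceBary k k) (faceBary k l) = 0 := by
    refine G.sum_eq_zero_of_glue _ fun i k => ?_
    rw [← Equiv.sum_comp (G.perm i k) fun l => e (G.nbr i k) (G.perm i k k) l • _,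
      ← Finset.sum_add_distrib]
    refine Finset.sum_eq_zero fun l _ => ?_
    rw [← relabel_faceBary, ← relabel_faceBary, F.seg_glue _ _ _ _ (faceBary_left _ _)
      (faceBary_left _ _), ← add_smul]
    rcases eq_or_ne k l with rfl | hkl
    · simp [hdiag]
    · rw [hglue i k l hkl, add_neg_cancel, zero_smul]
  have : F.chainClass (fun i k => ∑ l, e i k l) =
      ∑ i, ∑ k, ∑ l, e i k l • F.seg i bary (faceBary k l) -
        ∑ i, ∑ k, ∑ l, e i k l • F.seg i (faceBary k k) (faceBary k l) := by
    simp only [chainClass, Finset.sum_smul, ← Finset.sum_sub_distrib, ← smul_sub, ← hhalf]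
  rw [this, h2, sub_zero]
  exact Finset.sum_eq_zero fun i _ => h1 i

end TetGluing.IdealMap

end DualChains

/-! ## Alternating colorings -/

/-- Two fixed-point-free involutions admit a common alternating sign function, as the orbits of
their product are exchanged in pairs by each of them. -/
lemma exists_alternating_sign {X : Type} (σ τ : Equiv.Perm X) (hσ : ∀ x, σ (σ x) = x)
    (hτ : ∀ x, τ (τ x) = x) (hσ' : ∀ x, σ x ≠ x) (hτ' : ∀ x, τ x ≠ x) :
    ∃ ε : X → ℤ, (∀ x, ε x = 1 ∨ ε x = -1) ∧ (∀ x, ε (σ x) = -ε x) ∧ ∀ x, ε (τ x) = -ε x := by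
  classical
  have hσσ : σ⁻¹ = σ := inv_eq_of_mul_eq_one_left (Equiv.ext hσ)
  have hττ : τ⁻¹ = τ := inv_eq_of_mul_eq_one_left (Equiv.ext hτ)
  have hconj : SemiconjBy σ (σ * τ) (σ * τ)⁻¹ := by
    rw [SemiconjBy, mul_inv_rev, hσσ, hττ]
    ext x
    simp only [Equiv.Perm.mul_apply, hσ]
  have hpow : ∀ (j : ℤ) (x : X), σ (((σ * τ) ^ j) x) = ((σ * τ) ^ (-j)) (σ x) := fun j x => by
    have := (hconj.zpow_right j).eq
    rw [inv_zpow, ← zpow_neg] at this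
    exact Equiv.congr_fun this x
  have hτeq : ∀ x, τ x = σ ((σ * τ) x) := fun x => by
    rw [Equiv.Perm.mul_apply, hσ]
  -- If `(σ * τ) ^ j` took `x` to `σ x`, the halfway point `(σ * τ) ^ m x` would be fixed by `σ` for
  -- `j = 2m` and by `τ` for `j = 2m + 1`, as in a reflection of a cycle.
  have hne : ∀ x, ¬ (σ * τ).SameCycle x (σ x) := by
    rintro x ⟨j, hj⟩
    obtain ⟨m, rfl | rfl⟩ := Int.even_or_odd' j
    · refine hσ' (((σ * τ) ^ m) x) ?_
      rw [hpow, ← hj, ← Equiv.Perm.mul_apply, ← zpow_add]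
      congr 2
      omega
    · refine hτ' (((σ * τ) ^ m) x) ?_
      rw [hτeq, ← Equiv.Perm.mul_apply (σ * τ), ← zpow_one_add, hpow, ← hj, ← Equiv.Perm.mul_apply,
        ← zpow_add]
      congr 2
      omega
  -- Both `σ` and `τ` exchange the cycle of `x` with that of `σ x`. An arbitrary linear order on the
  -- cycles decides which of the two gets the sign `1`.
  let c : X → Quotient (Equiv.Perm.SameCycle.setoid (σ * τ)) := Quotient.mk _
  let _ : LinearOrder (Quotient (Equiv.Perm.SameCycle.setoid (σ * τ))) :=
    linearOrderOfSTO WellOrderingRel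
  have hc : ∀ x, c x ≠ c (σ x) := fun x h => hne x (Quotient.exact h)
  have hcτ : ∀ x, c (τ x) = c (σ x) := fun x => Quotient.sound ⟨1, by
    rw [zpow_one, Equiv.Perm.mul_apply, hτ]⟩
  have hcστ : ∀ x, c (σ (τ x)) = c x := fun x => Quotient.sound ⟨-1, by
    rw [zpow_neg_one]
    exact Equiv.symm_apply_apply (σ * τ) x⟩
  have hflip : ∀ a b : Quotient (Equiv.Perm.SameCycle.setoid (σ * τ)), a ≠ b →
      (if b < a then (1 : ℤ) else -1) = -if a < b then (1 : ℤ) else -1 := fun a b hab => by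
    rcases lt_or_gt_of_ne hab with h | h
    · rw [if_pos h, if_neg h.not_gt]
    · rw [if_pos h, if_neg h.not_gt, neg_neg]
  refine ⟨fun x => if c x < c (σ x) then 1 else -1, fun x => ?_, fun x => ?_, fun x => ?_⟩
  · dsimp only
    split_ifs <;> simp
  · dsimp only
    rw [hσ]
    exact hflip _ _ (hc x)
  · dsimp only
    rw [hcτ, hcστ]
    exact hflip _ _ (hc x)

/-! ### Pre-branchings compared with boundaries of regions -/

namespace TetGluing

/-- Every pre-branching differs from the boundary of a combination of regions by twice a cycle of
the dual spine. -/
lemma PreBranching.exists_coeff_eq {G : TetGluing} (w : G.PreBranching) :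
    ∃ (e : Fin G.n → Fin 4 → Fin 4 → ℤ) (c : Fin G.n → Fin 4 → ℤ),
      (∀ i k l, e i l k = -e i k l) ∧
      (∀ i k l, k ≠ l → e (G.nbr i k) (G.perm i k k) (G.perm i k l) = -e i k l) ∧
      G.IsDualCycle c ∧ w.coeff = (fun i k => ∑ l, e i k l) + (2 : ℤ) • c := by
  have hinv : ∀ i k l, G.perm (G.nbr i k) (G.perm i k k) (G.perm i k l) = l := fun i k l => by
    rw [G.perm_perm]
    exact Equiv.symm_apply_apply _ _
  -- An element of `X` is a corner of a region with one of its two sides marked. The map `s` marks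
  -- the other side, and `t` crosses the marked face into the next corner, so an alternating sign is
  -- an orientation of every region.
  let X := {a : Fin G.n × Fin 4 × Fin 4 // a.2.1 ≠ a.2.2}
  let s : X → X := fun a => ⟨(a.1.1, a.1.2.2, a.1.2.1), a.2.symm⟩
  let t : X → X := fun a => ⟨(G.nbr a.1.1 a.1.2.1, G.perm a.1.1 a.1.2.1 a.1.2.1,
    G.perm a.1.1 a.1.2.1 a.1.2.2), (G.perm _ _).injective.ne a.2⟩
  have hs : Function.Involutive s := fun a => rfl
  have ht : Function.Involutive t := by
    rintro ⟨⟨i, k, l⟩, h⟩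
    refine Subtype.ext ?_
    simp only [t, hinv, G.nbr_nbr]
  obtain ⟨ε, hε, hεs, hεt⟩ := exists_alternating_sign hs.toPerm ht.toPerm hs ht
    (fun a h => a.2 (congrArg (fun b : X => b.1.2.1) h).symm)
    (fun a h => G.no_fixed_face a.1.1 a.1.2.1 (Prod.ext (congrArg (fun b : X => b.1.1) h)
      (congrArg (fun b : X => b.1.2.1) h)))
  let e : Fin G.n → Fin 4 → Fin 4 → ℤ := fun i k l =>
    if h : k ≠ l then ε ⟨(i, k, l), h⟩ else 0
  have hswap : ∀ i k l, e i l k = -e i k l := fun i k l => by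
    rcases eq_or_ne k l with rfl | h
    · simp [e]
    · simp only [e, dif_pos h, dif_pos h.symm]
      exact hεs ⟨(i, k, l), h⟩
  have hglue : ∀ i k l, k ≠ l → e (G.nbr i k) (G.perm i k k) (G.perm i k l) = -e i k l := by
    intro i k l h
    simp only [e, dif_pos h, dif_pos ((G.perm i k).injective.ne h)]
    exact hεt ⟨(i, k, l), h⟩
  have hdiag : ∀ i k, e i k k = 0 := fun i k => dif_neg (by simp)
  have hone : ∀ i k l, k ≠ l → e i k l = 1 ∨ e i k l = -1 := fun i k l h => by
    simp only [e, dif_pos h]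
    exact hε _
  -- The sum has three terms `±1`, the one with `l = k` being `0`, so both members of the difference
  -- are odd.
  have hodd : ∀ i k, ∃ m, w.coeff i k - ∑ l, e i k l = 2 * m := fun i k => by
    have hw : w.coeff i k = 1 ∨ w.coeff i k = -1 := by
      simp only [PreBranching.coeff]
      split_ifs <;> simp
    rw [Fin.sum_univ_four]
    have h0 := hone i k 0
    have h1 := hone i k 1
    have h2 := hone i k 2
    have h3 := hone i k 3
    have hd := hdiag i k
    refine ⟨(w.coeff i k - (e i k 0 + e i k 1 + e i k 2 + e i k 3)) / 2, ?_⟩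
    fin_cases k <;> simp at h0 h1 h2 h3 hd hw ⊢ <;> omega
  choose c hc using hodd
  -- Both `w.coeff` and the region boundary satisfy the cycle conditions, hence so does `2 * c`; in
  -- `ℤ` the factor `2` cancels.
  refine ⟨e, c, hswap, hglue, ⟨fun i k => ?_, fun i => ?_⟩, ?_⟩
  · have h1 := hc (G.nbr i k) (G.perm i k k)
    have h2 := hc i k
    have h3 := w.isDualCycle_coeff.glue i k
    rw [← Equiv.sum_comp (G.perm i k)] at h1
    have h4 : ∑ l, e (G.nbr i k) (G.perm i k k) (G.perm i k l) = -∑ l, e i k l := by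
      rw [← Finset.sum_neg_distrib]
      refine Finset.sum_congr rfl fun l _ => ?_
      rcases eq_or_ne k l with rfl | h
      · simp [hdiag]
      · exact hglue i k l h
    omega
  · have h1 := Finset.sum_congr rfl fun k (_ : k ∈ Finset.univ) => hc i k
    rw [Finset.sum_sub_distrib, w.isDualCycle_coeff.sum, ← Finset.mul_sum] at h1
    have h2 : ∑ k, ∑ l, e i k l = -∑ k, ∑ l, e i k l := by
      conv_lhs => rw [Finset.sum_comm]
      simp only [← Finset.sum_neg_distrib, ← hswap]
    omega
  · ext i k
    have := hc i k
    simp only [Pi.add_apply, Pi.smul_apply, smul_eq_mul]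
    omega

/-- The pre-branching of a branching is the boundary of the sum of the oriented regions. -/
lemma Branching.exists_coeff_eq {G : TetGluing} (b : G.Branching) (o : G.Orientation) :
    ∃ e : Fin G.n → Fin 4 → Fin 4 → ℤ,
      (∀ i k l, e i l k = -e i k l) ∧
      (∀ i k l, k ≠ l → e (G.nbr i k) (G.perm i k k) (G.perm i k l) = -e i k l) ∧
      (b.toPreBranching o).coeff = fun i k => ∑ l, e i k l := by
  -- For `k ≠ l` exactly one `p` contributes, with `p 0`, `p 1` the ends of the edge opposite to `k`
  -- and `l` in branching order. The term is `1` when the induced orientation points outwards, in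
  -- the convention of `outwardInducing`.
  refine ⟨fun i k l => ∑ p : Equiv.Perm (Fin 4),
    if p 3 = k ∧ p 2 = l ∧ b.rank i (p 0) < b.rank i (p 1) then
      -((Equiv.Perm.sign p * o.sgn i : ℤˣ) : ℤ) else 0, fun i k l => ?_, fun i k l hkl => ?_, ?_⟩
  · rw [← Finset.sum_neg_distrib, ← Equiv.sum_comp (Equiv.mulRight (Equiv.swap (2 : Fin 4) 3))]
    refine Finset.sum_congr rfl fun p _ => ?_
    have h0 : Equiv.swap (2 : Fin 4) 3 0 = 0 := by decide
    have h1 : Equiv.swap (2 : Fin 4) 3 1 = 1 := by decide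
    have h23 : Equiv.Perm.sign (Equiv.swap (2 : Fin 4) 3) = -1 :=
      Equiv.Perm.sign_swap (by decide)
    simp only [Equiv.coe_mulRight, Equiv.Perm.mul_apply, Equiv.swap_apply_left,
      Equiv.swap_apply_right, h0, h1, Equiv.Perm.sign_mul, h23]
    rw [neg_ite, neg_zero]
    refine if_congr (by tauto) (by simp) rfl
  · rw [← Finset.sum_neg_distrib]
    refine (Equiv.sum_comp (Equiv.mulLeft (G.perm i k)) _).symm.trans ?_
    refine Finset.sum_congr rfl fun p _ => ?_
    simp only [Equiv.coe_mulLeft, Equiv.Perm.mul_apply, EmbeddingLike.apply_eq_iff_eq, o.glue,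
      Equiv.Perm.sign_mul]
    rw [neg_ite, neg_zero]
    by_cases h3 : p 3 = k
    · have hr := b.glue i k (p 0) (p 1) (h3 ▸ p.injective.ne (by decide))
        (h3 ▸ p.injective.ne (by decide))
      refine if_congr (by rw [hr]) ?_ rfl
      have : ∀ x y z : ℤˣ, -((x * y * -(x * z) : ℤˣ) : ℤ) = - -((y * z : ℤˣ) : ℤ) := by decide
      exact this _ _ _
    · rw [if_neg fun h => h3 h.1, if_neg fun h => h3 h.1]
  · have key : ∀ (ε : ℤˣ) (j : Fin 4), (∑ q : Equiv.Perm (Fin 4),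
        if q 3 = j ∧ q 0 < q 1 then -((Equiv.Perm.sign q * ε : ℤˣ) : ℤ) else 0) =
          if ε * (-1) ^ (j : ℕ) = 1 then 1 else -1 := by decide +kernel
    ext i k
    simp only [PreBranching.coeff, Branching.toPreBranching, decide_eq_true_eq,
      card_outwardInducing]
    rw [← key (Equiv.Perm.sign (b.rank i) * o.sgn i), Finset.sum_comm,
      ← Equiv.sum_comp (Equiv.mulLeft (b.rank i))]
    refine Finset.sum_congr rfl fun p _ => ?_
    rw [Finset.sum_eq_single (p 2) (fun l _ hl => if_neg fun h => hl h.2.1.symm) (by simp)]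
    simp only [Equiv.coe_mulLeft, Equiv.Perm.mul_apply, EmbeddingLike.apply_eq_iff_eq,
      Equiv.Perm.sign_mul, true_and]
    refine if_congr Iff.rfl ?_ rfl
    rw [mul_mul_mul_comm, Int.units_mul_self, one_mul]

end TetGluing

/-! ## The homology class of a pre-branching -/

section HomologyClass

open CategoryTheory openTetra

variable {M : Type} [TopologicalSpace M] [ChartedSpace (EuclideanHalfSpace 3) M]

namespace IdealTriangulation

/-- The identification of the realization with `M̂`, as an ideal map. -/
def idealMap (T : IdealTriangulation M) : T.gluing.IdealMap M where
  map := ⟨T.homeo, T.homeo.continuous⟩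
  avoids p hp h := hp ((T.isVertex_iff p).2 h)

variable [IsManifold (𝓡∂ 3) ∞ M] (T : IdealTriangulation M)

lemma dualEdgeChain_pOpcycles (i : Fin T.gluing.n) (k : Fin 4) :
    T.dualEdgeChain i k ≫ (singularChains M).pOpcycles 1 = T.idealMap.half i k := by
  refine (segClass_eq_pathClass _ _ _ _ (T.dualPath i k) fun u => ?_).symm
  refine congrArg (CollapsedManifold.unmarkedToManifold M) (Subtype.ext ?_)
  exact congrArg (fun x => T.homeo (T.gluing.point i x)) (toTetra_segPoint_half k u)

/-- The singular chain of a combination of halves of dual edges. -/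
noncomputable def dualChain (c : Fin T.gluing.n → Fin 4 → ℤ) :
    ModuleCat.of ℤ ℤ ⟶ (singularChains M).X 1 :=
  ∑ i, ∑ k, c i k • T.dualEdgeChain i k

lemma dualChain_pOpcycles (c : Fin T.gluing.n → Fin 4 → ℤ) :
    T.dualChain c ≫ (singularChains M).pOpcycles 1 = T.idealMap.chainClass c := by
  simp only [dualChain, Preadditive.sum_comp, Preadditive.zsmul_comp, dualEdgeChain_pOpcycles,
    TetGluing.IdealMap.chainClass]

lemma dualChain_d {c : Fin T.gluing.n → Fin 4 → ℤ} (hc : T.gluing.IsDualCycle c) :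
    T.dualChain c ≫ (singularChains M).d 1 0 = 0 := by
  have hF : ∑ i, ∑ k, c i k • T.dualEnd i k 0 = 0 :=
    T.gluing.sum_eq_zero_of_glue _ fun i k => by
      rw [hc.glue, dualEnd_zero, neg_smul, add_neg_cancel]
  simp only [dualChain, Preadditive.sum_comp, Preadditive.zsmul_comp, dualEdgeChain_d,
    smul_sub, Finset.sum_sub_distrib, hF, zero_sub, neg_eq_zero]
  refine Finset.sum_eq_zero fun i _ => ?_
  rw [Finset.sum_congr rfl (fun k _ => by rw [T.dualEnd_one i k]), ← Finset.sum_smul, hc.sum,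
    zero_smul]

/-- The homology class of a cycle of the dual spine. -/
noncomputable def dualCycleHom {c : Fin T.gluing.n → Fin 4 → ℤ} (hc : T.gluing.IsDualCycle c) :
    ModuleCat.of ℤ ℤ ⟶ (singularChains M).homology 1 :=
  (singularChains M).liftCycles (T.dualChain c) 0 (by simp) (T.dualChain_d hc) ≫
    (singularChains M).homologyπ 1

/-- Modulo boundaries the class of a cycle splits into its open pieces, so that the halves can be
compared one at a time. -/
lemma dualCycleHom_homologyι {c : Fin T.gluing.n → Fin 4 → ℤ} (hc : T.gluing.IsDualCycle c) :
    T.dualCycleHom hc ≫ (singularChains M).homologyι 1 = T.idealMap.chainClass c := by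
  rw [← dualChain_pOpcycles]
  simp [dualCycleHom]

end IdealTriangulation

lemma homologyι_injective {M : Type} [TopologicalSpace M]
    {f g : ModuleCat.of ℤ ℤ ⟶ (singularChains M).homology 1}
    (h : f ≫ (singularChains M).homologyι 1 = g ≫ (singularChains M).homologyι 1) : f = g :=
  (cancel_mono ((singularChains M).homologyι 1)).1 h

namespace PreBranchedTriangulation

variable [IsManifold (𝓡∂ 3) ∞ M] (P P' : PreBranchedTriangulation M)

lemma homologyClass_eq :
    P.homologyClass = (P.T.dualCycleHom P.w.isDualCycle_coeff).hom (1 : ℤ) := rfl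

lemma homologyClass_eq_of_chainClass_eq
    (h : P'.T.idealMap.chainClass P'.w.coeff = P.T.idealMap.chainClass P.w.coeff) :
    P'.homologyClass = P.homologyClass := by
  rw [homologyClass_eq, homologyClass_eq]
  congr 2
  refine homologyι_injective ?_
  rw [P'.T.dualCycleHom_homologyι, P.T.dualCycleHom_homologyι, h]

lemma homologyClass_even : ∃ α : H1 ℤ M, P.homologyClass = (2 : ℤ) • α := by
  obtain ⟨e, c, hswap, hglue, hc, h⟩ := P.w.exists_coeff_eq
  refine ⟨(P.T.dualCycleHom hc).hom (1 : ℤ), ?_⟩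
  have : P.T.dualCycleHom P.w.isDualCycle_coeff = (2 : ℤ) • P.T.dualCycleHom hc := by
    refine homologyι_injective ?_
    rw [Preadditive.zsmul_comp, P.T.dualCycleHom_homologyι, P.T.dualCycleHom_homologyι, h,
      TetGluing.IdealMap.chainClass_add, TetGluing.IdealMap.chainClass_smul,
      TetGluing.IdealMap.chainClass_regionBoundary _ e hswap hglue, zero_add]
  rw [homologyClass_eq, this]
  rfl

lemma homologyClass_eq_zero_of_branching (o : P.T.gluing.Orientation) (b : P.T.gluing.Branching)
    (h : P.w = b.toPreBranching o) : P.homologyClass = 0 := by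
  obtain ⟨e, hswap, hglue, he⟩ := b.exists_coeff_eq o
  have : P.T.dualCycleHom P.w.isDualCycle_coeff = 0 := by
    refine homologyι_injective ?_
    rw [P.T.dualCycleHom_homologyι, h, he,
      TetGluing.IdealMap.chainClass_regionBoundary _ e hswap hglue, Limits.zero_comp]
  rw [homologyClass_eq, this]
  rfl

end PreBranchedTriangulation

/-- Singular homology is additive in the coefficients, and twice the map `ℤ → ℤ/2` is zero. -/
lemma two_smul_reduceModTwo (M : Type) [TopologicalSpace M] :
    (2 : ℤ) • reduceModTwo M = 0 := by
  let F : ModuleCat.{0} ℤ ⥤ ModuleCat.{0} ℤ :=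
    AlgebraicTopology.singularHomologyFunctor (ModuleCat.{0} ℤ) 1 ⋙
      (evaluation _ _).obj (TopCat.of M)
  have hadd : ∀ {X Y : ModuleCat.{0} ℤ} (f g : X ⟶ Y), F.map (f + g) = F.map f + F.map g := by
    intro X Y f g
    change HomologicalComplex.homologyMap (((AlgebraicTopology.singularChainComplexFunctor
      (ModuleCat.{0} ℤ)).map (f + g)).app (TopCat.of M)) 1 = _
    rw [Functor.map_add, NatTrans.app_add, HomologicalComplex.homologyMap_add]
    rfl
  let f : ModuleCat.of ℤ ℤ ⟶ ModuleCat.of ℤ (ZMod 2) :=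
    ModuleCat.ofHom (Int.castAddHom (ZMod 2)).toIntLinearMap
  have hf : f + f = 0 := by
    ext
    change ((1 : ℤ) : ZMod 2) + ((1 : ℤ) : ZMod 2) = 0
    decide
  have hzero : F.map (0 : ModuleCat.of ℤ ℤ ⟶ ModuleCat.of ℤ (ZMod 2)) = 0 := by
    have := hadd (0 : ModuleCat.of ℤ ℤ ⟶ ModuleCat.of ℤ (ZMod 2)) 0
    rwa [add_zero, left_eq_add] at this
  change (2 : ℤ) • F.map f = 0
  rw [two_zsmul, ← hadd, hf, hzero]

lemma reduceModTwo_two_smul (M : Type) [TopologicalSpace M] (α : H1 ℤ M) :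
    (reduceModTwo M).hom ((2 : ℤ) • α) = 0 := by
  rw [map_zsmul]
  exact congrArg (fun f => ModuleCat.Hom.hom f α) (two_smul_reduceModTwo M)

end HomologyClass

/-! ## Invariance under isotopy and under the quadrilateral moves -/

section Homotopy

open openTetra

variable {M : Type} [TopologicalSpace M] [ChartedSpace (EuclideanHalfSpace 3) M]

lemma TetGluing.exists_openTetra {G : TetGluing} {p : G.Space} (hp : ¬ G.IsVertex p) :
    ∃ (i : Fin G.n) (x : openTetra), p = G.point i (toTetra x) := by
  obtain ⟨⟨i, x⟩, rfl⟩ := Quot.exists_rep p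
  exact ⟨i, ⟨x.1, x.2, fun v hv => hp ⟨v, hv⟩⟩, rfl⟩

/-- The prism over the tetrahedron without its vertices. -/
def openPrism : Set (ℝ × (Fin 4 → ℝ)) := Set.Icc 0 1 ×ˢ openTetra

lemma convex_openPrism : Convex ℝ openPrism := (convex_Icc 0 1).prod convex_openTetra

/-- A point of the prism. -/
def openPrism.mk (s : unitInterval) (x : openTetra) : openPrism := ⟨(s.1, x.1), s.2, x.2⟩

variable [IsManifold (𝓡∂ 3) ∞ M]

/-- Prism argument: a half at time `0` differs from the half at time `1` by the tracks of its two
ends. Tracks of barycenters of tetrahedra cancel because the coefficients in each tetrahedron sum to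
zero, tracks of face barycenters because they are shared by glued faces. -/
lemma TetGluing.IdealMap.chainClass_eq_of_homotopy {G : TetGluing} (F F' : G.IdealMap M)
    (H : C(unitInterval × G.Space, CollapsedManifold M))
    (hH : ∀ s p, ¬ G.IsVertex p → H (s, p) ∉ CollapsedManifold.marked M)
    (h0 : ∀ p, H (0, p) = F.map p) (h1 : ∀ p, H (1, p) = F'.map p)
    {c : Fin G.n → Fin 4 → ℤ} (hc : G.IsDualCycle c) : F.chainClass c = F'.chainClass c := by
  let φ : Fin G.n → C(openPrism, M) := fun i =>
    (CollapsedManifold.unmarkedToManifold M).comp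
      ⟨fun a => ⟨H (⟨a.1.1, a.2.1⟩, G.point i (toTetra ⟨a.1.2, a.2.2⟩)),
        hH _ _ (G.not_isVertex_point i _)⟩,
        Continuous.subtype_mk (H.continuous.comp (Continuous.prodMk
          (Continuous.subtype_mk (continuous_fst.comp continuous_subtype_val) _)
          ((G.continuous_point i).comp (continuous_toTetra.comp
            (Continuous.subtype_mk (continuous_snd.comp continuous_subtype_val) _))))) _⟩
  have hφ : ∀ {i i' a a'}, H (⟨a.1.1, a.2.1⟩, G.point i (toTetra ⟨a.1.2, a.2.2⟩)) =
      H (⟨a'.1.1, a'.2.1⟩, G.point i' (toTetra ⟨a'.1.2, a'.2.2⟩)) → φ i a = φ i' a' :=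
    fun h => congrArg (CollapsedManifold.unmarkedToManifold M) (Subtype.ext h)
  let S : ∀ (i : Fin G.n) (a b : openPrism), ChainClass M := fun i =>
    segClass convex_openPrism (φ i)
  let V : ∀ (i : Fin G.n) (x : openTetra), ChainClass M := fun i x =>
    S i (openPrism.mk 0 x) (openPrism.mk 1 x)
  have hS0 : ∀ i x y, S i (openPrism.mk 0 x) (openPrism.mk 0 y) = F.seg i x y := by
    intro i x y
    refine segClass_congr _ _ _ _ _ _ _ _ fun u => ?_
    refine congrArg (CollapsedManifold.unmarkedToManifold M) (Subtype.ext ?_)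
    refine Eq.trans ?_ (h0 _)
    refine congrArg H (Prod.ext (Subtype.ext ?_) rfl)
    change u.1 0 * 0 + u.1 1 * 0 = (0 : ℝ)
    ring
  have hS1 : ∀ i x y, S i (openPrism.mk 1 x) (openPrism.mk 1 y) = F'.seg i x y := by
    intro i x y
    refine segClass_congr _ _ _ _ _ _ _ _ fun u => ?_
    refine congrArg (CollapsedManifold.unmarkedToManifold M) (Subtype.ext ?_)
    refine Eq.trans ?_ (h1 _)
    refine congrArg H (Prod.ext (Subtype.ext ?_) rfl)
    change u.1 0 * 1 + u.1 1 * 1 = (1 : ℝ)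
    rw [mul_one, mul_one, ← u.2.2, Fin.sum_univ_two]
  have hV : ∀ i k x, x.1 k = 0 → V (G.nbr i k) (relabel (G.perm i k) x) = V i x := by
    intro i k x hx
    refine segClass_congr _ _ _ _ _ _ _ _ fun u => hφ ?_
    refine congrArg H (Prod.ext rfl ?_)
    refine G.point_relabel i k (segPoint convex_openTetra x x u) ?_
    change u.1 0 * x.1 k + u.1 1 * x.1 k = 0
    simp [hx]
  have hhalf : ∀ i k, F.half i k = V i bary + F'.half i k - V i (faceBary k k) := fun i k => by
    rw [eq_sub_iff_add_eq, TetGluing.IdealMap.half, TetGluing.IdealMap.half, ← hS0, ← hS1]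
    exact (segClass_add _ _ _ _ _).trans (segClass_add _ _ _ _ _).symm
  have hA : ∑ i, ∑ k, c i k • V i bary = 0 :=
    Finset.sum_eq_zero fun i _ => by rw [← Finset.sum_smul, hc.sum, zero_smul]
  have hB : ∑ i, ∑ k, c i k • V i (faceBary k k) = 0 :=
    G.sum_eq_zero_of_glue _ fun i k => by
      rw [← relabel_faceBary, hV _ _ _ (faceBary_left _ _), hc.glue, neg_smul, add_neg_cancel]
  simp only [TetGluing.IdealMap.chainClass, hhalf, smul_sub, smul_add, Finset.sum_sub_distrib,
    Finset.sum_add_distrib, hA, hB, zero_add, sub_zero]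

/-- The end map `f` need not be injective (a flattened pillow is the case in point), so at the final
time `hf` has to replace the homeomorphism argument. -/
lemma IdealTriangulation.DeformsTo.exists_idealMap {T : IdealTriangulation M}
    {f : T.gluing.Space → CollapsedManifold M} (h : T.DeformsTo f)
    (hf : ∀ p, ¬ T.gluing.IsVertex p → f p ∉ CollapsedManifold.marked M) :
    ∃ F : T.gluing.IdealMap M, (∀ p, F.map p = f p) ∧
      ∀ c, T.gluing.IsDualCycle c → T.idealMap.chainClass c = F.chainClass c := by
  obtain ⟨H, h0, h1, hg, hv⟩ := h
  refine ⟨⟨H.comp ⟨fun p => (1, p), by fun_prop⟩, fun p hp => ?_⟩, h1, fun c hc => ?_⟩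
  · change H (1, p) ∉ _
    rw [h1]
    exact hf p hp
  · refine TetGluing.IdealMap.chainClass_eq_of_homotopy _ _ H (fun s p hp => ?_) h0
      (fun _ => rfl) hc
    rcases (unitInterval.le_one' : s ≤ 1).lt_or_eq with hs | rfl
    -- At an earlier time each marked point is already the image of a vertex, since vertices do not
    -- move; by injectivity it is the image of nothing else.
    · obtain ⟨g, hg⟩ := hg s hs
      intro hmem
      obtain ⟨q, hq⟩ := T.homeo.surjective (H (s, p))
      have hqv : T.gluing.IsVertex q := (T.isVertex_iff q).2 (hq ▸ hmem)
      have := hv s q hqv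
      rw [hq, hg, hg] at this
      exact hp (g.injective this ▸ hqv)
    · rw [h1]
      exact hf p hp

namespace PreBranchedTriangulation

variable {P P' : PreBranchedTriangulation M}

lemma Isotopic.homologyClass_eq (h : P.Isotopic P') : P'.homologyClass = P.homologyClass := by
  obtain ⟨R, ⟨f, hdef, hf⟩, hw⟩ := h
  have hpt : ∀ i (x : openTetra),
      f (P'.T.gluing.point (R.e i) (toTetra (relabel (R.r i) x))) =
        P.T.homeo (P.T.gluing.point i (toTetra x)) := fun i x => by
    rw [toTetra_relabel]
    exact hf i _
  obtain ⟨F, hF, hcl⟩ := hdef.exists_idealMap (fun p hp => by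
    obtain ⟨i, x, rfl⟩ := TetGluing.exists_openTetra hp
    obtain ⟨i, rfl⟩ := R.e.surjective i
    have := hpt i (relabel (R.r i).symm x)
    rw [show relabel (R.r i) (relabel (R.r i).symm x) = x from
      Subtype.ext (funext fun v => congrArg x.1 ((R.r i).apply_symm_apply v))] at this
    rw [this]
    exact P.T.idealMap.avoids _ (P.T.gluing.not_isVertex_point _ _))
  refine homologyClass_eq_of_chainClass_eq _ _ ?_
  rw [hcl _ P'.w.isDualCycle_coeff, TetGluing.IdealMap.chainClass, ← Equiv.sum_comp R.e]
  refine Finset.sum_congr rfl fun i _ => ?_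
  rw [← Equiv.sum_comp (R.r i)]
  refine Finset.sum_congr rfl fun k _ => ?_
  congr 1
  · simp only [TetGluing.PreBranching.coeff, hw]
  · refine TetGluing.IdealMap.seg_congr _ _ fun u => ?_
    rw [hF, ← relabel_faceBary, ← relabel_bary (R.r i), segPoint_relabel, hpt]
    rfl

end PreBranchedTriangulation

/-! ### Invariance under the quadrilateral moves -/

/-- The flattening of a pillow tetrahedron. -/
noncomputable def openTetra.pillow (x : openTetra) : openTetra :=
  ⟨TetGluing.pillowCoord x.1, by
    have h0 := nonneg x 0
    have h1 := nonneg x 1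
    have h2 := nonneg x 2
    have h3 := nonneg x 3
    have hs := sum_eq_one x
    have n0 : x.1 0 ≠ 1 := x.2.2 0
    have n1 : x.1 1 ≠ 1 := x.2.2 1
    have n2 : x.1 2 ≠ 1 := x.2.2 2
    have n3 : x.1 3 ≠ 1 := x.2.2 3
    -- A flattened coordinate can be `1` only if the subtracted minimum is `0` and `x` is itself a
    -- vertex.
    rcases le_total (x.1 2) (x.1 3) with h | h
    · refine ⟨⟨fun v => ?_, ?_⟩, fun v => ?_⟩
      · fin_cases v <;> simp [TetGluing.pillowCoord, min_eq_left h] <;> linarith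
      · simp only [Fin.sum_univ_four, TetGluing.pillowCoord, min_eq_left h, Matrix.cons_val]
        linarith
      · fin_cases v <;> simp [TetGluing.pillowCoord, min_eq_left h]
        · exact fun e => n0 (by linarith)
        · exact fun e => n1 (by linarith)
        · exact fun e => n3 (by linarith)
    · refine ⟨⟨fun v => ?_, ?_⟩, fun v => ?_⟩
      · fin_cases v <;> simp [TetGluing.pillowCoord, min_eq_right h] <;> linarith
      · simp only [Fin.sum_univ_four, TetGluing.pillowCoord, min_eq_right h, Matrix.cons_val]
        linarith
      · fin_cases v <;> simp [TetGluing.pillowCoord, min_eq_right h]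
        · exact fun e => n0 (by linarith)
        · exact fun e => n1 (by linarith)
        · exact fun e => n2 (by linarith)⟩

lemma openTetra.relabel_apply (g : Equiv.Perm (Fin 4)) (x : openTetra) (v : Fin 4) :
    (relabel g x).1 (g v) = x.1 v := congrArg x.1 (g.symm_apply_apply v)

lemma TetGluing.IsDualCycle.eq_neg {G : TetGluing} {c : Fin G.n → Fin 4 → ℤ}
    (hc : G.IsDualCycle c) {i i' : Fin G.n} {k : Fin 4} {g : Equiv.Perm (Fin 4)}
    (h : G.nbr i k = i' ∧ G.perm i k = g) : c i' (g k) = -c i k := by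
  rw [← h.1, ← h.2, hc.glue]

namespace PreBranchedTriangulation

variable {P P' : PreBranchedTriangulation M}

/-- Flattening gives the two pillow tetrahedra the same halves, and their coefficients are opposite,
so the pillow contributes nothing. -/
lemma Quad.homologyClass_eq (h : P.Quad P') : P'.homologyClass = P.homologyClass := by
  obtain ⟨D, hD, ⟨f, hdef, hold, hleft, hright⟩, hw⟩ := h
  have hnew : ∀ x : openTetra, ∃ i y, ∀ s,
      f (P'.T.gluing.point (D.new s) (toTetra x)) =
        P.T.homeo (P.T.gluing.point i (toTetra y)) := by
    intro x
    rcases le_total (x.1 3) (x.1 2) with h | h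
    · exact ⟨_, relabel D.start.2 (pillow x), fun s => hleft s (toTetra x)
        (toTetra (relabel D.start.2 (pillow x))) h
        (relabel_apply _ (pillow x))⟩
    · exact ⟨_, relabel D.last.2 (pillow x), fun s => hright s (toTetra x)
        (toTetra (relabel D.last.2 (pillow x))) h
        (relabel_apply _ (pillow x))⟩
  obtain ⟨F, hF, hcl⟩ := hdef.exists_idealMap (fun p hp => by
    obtain ⟨i, x, rfl⟩ := TetGluing.exists_openTetra hp
    obtain ⟨i | s, rfl⟩ := D.e.surjective i
    · rw [show f (P'.T.gluing.point (D.e (Sum.inl i)) (toTetra x)) = _ from hold i (toTetra x)]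
      exact P.T.idealMap.avoids _ (P.T.gluing.not_isVertex_point _ _)
    · obtain ⟨i, y, hy⟩ := hnew x
      rw [show f (P'.T.gluing.point (D.e (Sum.inr s)) (toTetra x)) = _ from hy s]
      exact P.T.idealMap.avoids _ (P.T.gluing.not_isVertex_point _ _))
  have hc := P.w.isDualCycle_coeff
  have hc' := P'.w.isDualCycle_coeff
  have hcoeff : ∀ i k, P'.w.coeff (D.old i) k = P.w.coeff i k := fun i k => by
    simp only [TetGluing.PreBranching.coeff, hw]
  have hhalf : ∀ k, F.half (D.new 1) k = F.half (D.new 0) k := fun k => by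
    refine TetGluing.IdealMap.seg_congr _ _ fun u => ?_
    obtain ⟨i, y, hy⟩ := hnew (segPoint convex_openTetra bary (faceBary k k) u)
    rw [hF, hF, hy 0, hy 1]
  -- The faces `0` and `1` are glued to each other. The faces `3` and `2` are the copies of `t₁` and
  -- `t₂`: equal transverse orientations on the two copies mean outgoing on one side of the pillow
  -- and ingoing on the other.
  have hsign : ∀ k, P'.w.coeff (D.new 1) k = -P'.w.coeff (D.new 0) k := by
    have hin := fun k hk => hc'.eq_neg (hD.new_glue k hk)
    have h3 := hc'.eq_neg hD.first_front
    have h2 := hc'.eq_neg hD.second_front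
    have h3' := hc'.eq_neg hD.first_back
    have h2' := hc'.eq_neg hD.second_back
    rw [hcoeff] at h2 h3 h2' h3'
    rw [Equiv.Perm.mul_apply, hc.glue] at h2' h3'
    intro k
    fin_cases k
    · exact hin 0 (Or.inl rfl)
    · exact hin 1 (Or.inr rfl)
    · change P'.w.coeff (D.new 1) 2 = -P'.w.coeff (D.new 0) 2
      omega
    · change P'.w.coeff (D.new 1) 3 = -P'.w.coeff (D.new 0) 3
      omega
  refine homologyClass_eq_of_chainClass_eq _ _ ?_
  rw [hcl _ hc', TetGluing.IdealMap.chainClass, ← Equiv.sum_comp D.e, Fintype.sum_sum_type]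
  have hpillow : ∑ s, ∑ k, P'.w.coeff (D.e (Sum.inr s)) k • F.half (D.e (Sum.inr s)) k = 0 := by
    rw [Fin.sum_univ_two, ← Finset.sum_add_distrib]
    refine Finset.sum_eq_zero fun k _ => ?_
    change P'.w.coeff (D.new 0) k • F.half (D.new 0) k +
      P'.w.coeff (D.new 1) k • F.half (D.new 1) k = 0
    rw [hhalf, hsign, neg_smul, add_neg_cancel]
  rw [hpillow, add_zero]
  refine Finset.sum_congr rfl fun i _ => Finset.sum_congr rfl fun k _ => ?_
  congr 1
  · exact hcoeff i k
  · refine TetGluing.IdealMap.seg_congr _ _ fun u => ?_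
    rw [hF]
    exact hold i _

end PreBranchedTriangulation

end Homotopy

/-! ## Invariance under the `2 → 3` moves -/

section TwoThree

open openTetra TetGluing

/-- The position in the first tetrahedron of a `2 → 3` move of a point of the `j`-th new one. -/
noncomputable def openTetra.bipyramid (j : Fin 3) (x : openTetra)
    (h : x.1 j.castSucc ≤ x.1 3) : openTetra :=
  ⟨bipyramidCoord j x.1, by
    have h0 := nonneg x 0
    have h1 := nonneg x 1
    have h2 := nonneg x 2
    have h3 := nonneg x 3
    have hs := sum_eq_one x
    have hlt : ∀ v, x.1 v < 1 := fun v =>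
      lt_of_le_of_ne (mem_Icc_of_mem_stdSimplex x.2.1 v).2 (x.2.2 v)
    have l0 := hlt 0
    have l1 := hlt 1
    have l2 := hlt 2
    have l3 := hlt 3
    refine ⟨⟨fun v => ?_, ?_⟩, fun v => ne_of_lt ?_⟩
    · fin_cases j <;> fin_cases v <;> simp [bipyramidCoord] at h ⊢ <;> linarith
    · rw [Fin.sum_univ_four]
      fin_cases j <;> simp [bipyramidCoord] at h ⊢ <;> linarith
    · fin_cases j <;> fin_cases v <;> simp [bipyramidCoord] at h ⊢ <;> linarith⟩

/-- `bipyramidCoord j` is linear in the coordinates, so segments within the half `x j ≤ x 3` stay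
affine in the old tetrahedron. -/
lemma openTetra.bipyramid_segPoint (j : Fin 3) (x y : openTetra)
    (hx : x.1 j.castSucc ≤ x.1 3) (hy : y.1 j.castSucc ≤ y.1 3) (u : stdSimplex ℝ (Fin 2))
    (h : (segPoint convex_openTetra x y u).1 j.castSucc ≤ (segPoint convex_openTetra x y u).1 3) :
    bipyramid j (segPoint convex_openTetra x y u) h =
      segPoint convex_openTetra (bipyramid j x hx) (bipyramid j y hy) u := by
  refine Subtype.ext (funext fun v => ?_)
  change bipyramidCoord j (fun v => u.1 0 * x.1 v + u.1 1 * y.1 v) v =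
    u.1 0 * bipyramidCoord j x.1 v + u.1 1 * bipyramidCoord j y.1 v
  unfold bipyramidCoord
  split_ifs <;> ring

lemma openTetra.segPoint_le (x y : openTetra) {a b : Fin 4} (hx : x.1 a ≤ x.1 b)
    (hy : y.1 a ≤ y.1 b) (u : stdSimplex ℝ (Fin 2)) :
    (segPoint convex_openTetra x y u).1 a ≤ (segPoint convex_openTetra x y u).1 b :=
  add_le_add (mul_le_mul_of_nonneg_left hx (u.2.1 0)) (mul_le_mul_of_nonneg_left hy (u.2.1 1))

/-- Ensures that the halves towards the faces with labels below `3` lie on the side of the first old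
tetrahedron. -/
lemma openTetra.faceBary_castSucc_le (j l : Fin 3) :
    (faceBary l.castSucc l.castSucc).1 j.castSucc ≤ (faceBary l.castSucc l.castSucc).1 3 := by
  change (if j.castSucc = l.castSucc ∨ j.castSucc = l.castSucc then (0 : ℝ) else
    if l.castSucc = l.castSucc then 1 / 3 else 1 / 2) ≤ if 3 = l.castSucc ∨ 3 = l.castSucc then 0
      else if l.castSucc = l.castSucc then 1 / 3 else 1 / 2
  rw [if_neg (c := 3 = l.castSucc ∨ _) (by
    rw [or_self]; exact (Fin.castSucc_lt_last l).ne')]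
  split_ifs <;> norm_num

lemma openTetra.bipyramid_faceBary_self (j : Fin 3) :
    bipyramid j (faceBary j.castSucc j.castSucc) (faceBary_castSucc_le j j) =
      faceBary j.castSucc j.castSucc := by
  refine Subtype.ext (funext fun v => ?_)
  change bipyramidCoord j (faceBary j.castSucc j.castSucc).1 v = _
  fin_cases j <;> fin_cases v <;> simp [bipyramidCoord, faceBary]

/-- For `j ≠ l` both sides are the barycenter of the inner face between the `j`-th and `l`-th new
tetrahedra. -/
lemma openTetra.bipyramid_faceBary_comm (j l : Fin 3) :
    bipyramid j (faceBary l.castSucc l.castSucc) (faceBary_castSucc_le j l) =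
      bipyramid l (faceBary j.castSucc j.castSucc) (faceBary_castSucc_le l j) := by
  refine Subtype.ext (funext fun v => ?_)
  change bipyramidCoord j (faceBary l.castSucc l.castSucc).1 v =
    bipyramidCoord l (faceBary j.castSucc j.castSucc).1 v
  fin_cases j <;> fin_cases l <;> fin_cases v <;> simp [bipyramidCoord, faceBary]

variable {M : Type} [TopologicalSpace M] [ChartedSpace (EuclideanHalfSpace 3) M]
  [IsManifold (𝓡∂ 3) ∞ M]

namespace PreBranchedTriangulation

variable {P P' : PreBranchedTriangulation M}

/-- The barycenters of the new tetrahedra and of the inner faces lie on the common triangle `t`, so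
each new half is a segment of one old tetrahedron. In terms of potentials, tetrahedron barycenters
drop out because coefficients sum to zero, and inner faces cancel in pairs. -/
lemma TwoThree.homologyClass_eq (h : P.TwoThree P') : P'.homologyClass = P.homologyClass := by
  obtain ⟨D, hD, hkept, hfirst, hsecond, hw⟩ := h
  have hc := P.w.isDualCycle_coeff
  have hc' := P'.w.isDualCycle_coeff
  have hcoeff : ∀ i k i' r, D.Side i k i' r → P'.w.coeff i' (r k) = P.w.coeff i k :=
    fun i k i' r hs => by simp only [PreBranching.coeff, hw i k i' r hs]
  let F := P.T.idealMap
  let F' := P'.T.idealMap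
  -- segments of the new tetrahedra lying in one of the two old ones
  have segFirst : ∀ j x y hx hy, F'.seg (D.new j) x y =
      F.seg D.τ (relabel D.p (bipyramid j x hx)) (relabel D.p (bipyramid j y hy)) := by
    intro j x y hx hy
    refine IdealMap.seg_congr _ _ fun u => ?_
    rw [segPoint_relabel, ← bipyramid_segPoint j x y hx hy u (segPoint_le x y hx hy u)]
    exact hfirst j (toTetra _) (toTetra _) (segPoint_le x y hx hy u)
      (relabel_apply D.p (bipyramid j (segPoint convex_openTetra x y u) (segPoint_le x y hx hy u)))
  have segSecond : ∀ (j : Fin 3) x y hx hy,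
      F'.seg (D.new j) (relabel (Equiv.swap j.castSucc 3) x)
        (relabel (Equiv.swap j.castSucc 3) y) =
      F.seg D.τ₂ (relabel D.q (bipyramid j x hx)) (relabel D.q (bipyramid j y hy)) := by
    intro j x y hx hy
    have hle := segPoint_le x y hx hy
    refine IdealMap.seg_congr _ _ fun u => ?_
    rw [segPoint_relabel, segPoint_relabel, ← bipyramid_segPoint j x y hx hy u (hle u)]
    refine hsecond j (toTetra _) (toTetra _) ?_ fun v => ?_
    · change (relabel (Equiv.swap j.castSucc 3) (segPoint convex_openTetra x y u)).1 3 ≤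
        (relabel (Equiv.swap j.castSucc 3) (segPoint convex_openTetra x y u)).1 j.castSucc
      have h1 := relabel_apply (Equiv.swap j.castSucc 3) (segPoint convex_openTetra x y u) 3
      have h2 := relabel_apply (Equiv.swap j.castSucc 3) (segPoint convex_openTetra x y u)
        j.castSucc
      rw [Equiv.swap_apply_right] at h1
      rw [Equiv.swap_apply_left] at h2
      rw [h1, h2]
      exact hle u
    · refine (relabel_apply D.q
        (bipyramid j (segPoint convex_openTetra x y u) (hle u)) v).trans ?_
      change bipyramidCoord j _ v = bipyramidCoord j _ v
      congr 1
      exact funext fun v => (relabel_apply _ _ v).symm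
  -- potentials
  let c := faceBary 3 3
  let u : openTetra → ChainClass M := fun x => F.seg D.τ (relabel D.p c) (relabel D.p x)
  let u₂ : openTetra → ChainClass M := fun x => F.seg D.τ₂ (relabel D.q c) (relabel D.q x)
  have hu : ∀ x y, F.seg D.τ (relabel D.p x) (relabel D.p y) = u y - u x := fun x y => by
    rw [eq_sub_iff_add_eq, add_comm]
    exact F.seg_add _ _ _ _
  have hu₂ : ∀ x y, F.seg D.τ₂ (relabel D.q x) (relabel D.q y) = u₂ y - u₂ x := fun x y => by
    rw [eq_sub_iff_add_eq, add_comm]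
    exact F.seg_add _ _ _ _
  have huc : u c = 0 := F.seg_self _ _
  have hu₂c : u₂ c = 0 := F.seg_self _ _
  -- The base point `c` is the barycenter of `t` seen from either side, so the two potentials agree
  -- on `t`.
  have huu : ∀ x : openTetra, x.1 3 = 0 → u₂ x = u x := fun x hx =>
    F.seg_glue D.τ (D.p 3) (relabel D.p c) (relabel D.p x)
      ((relabel_apply _ _ _).trans (faceBary_left 3 3)) ((relabel_apply _ _ _).trans hx)
  have hb : ∀ j : Fin 3, bary.1 j.castSucc ≤ bary.1 3 := fun j => le_rfl
  let m : Fin 3 → openTetra := fun j => bipyramid j bary (hb j)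
  have hm : ∀ j, u₂ (m j) = u (m j) := fun j => huu _ (by
    change bipyramidCoord j (fun _ => 1 / 4) 3 = 0
    simp [bipyramidCoord])
  let z : Fin 3 → Fin 3 → openTetra := fun j l =>
    bipyramid j (faceBary l.castSucc l.castSucc) (faceBary_castSucc_le j l)
  let f : Fin 4 → openTetra := fun k => faceBary k k
  -- the old tetrahedra
  have hτ : ∑ k, P.w.coeff D.τ k • F.half D.τ k =
      ∑ j : Fin 3, P.w.coeff D.τ (D.p j.castSucc) • u (f j.castSucc) := by
    have h1 : ∀ k, F.half D.τ (D.p k) = u (f k) - u bary := fun k => by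
      rw [IdealMap.half, ← relabel_faceBary]
      exact hu bary (f k)
    rw [← Equiv.sum_comp D.p]
    simp only [h1, smul_sub]
    rw [Finset.sum_sub_distrib, ← Finset.sum_smul, Equiv.sum_comp D.p (P.w.coeff D.τ), hc.sum,
      zero_smul, sub_zero, Fin.sum_univ_castSucc]
    -- The dual edge through `t` contributes nothing, its midpoint being the base point.
    change _ + _ • u c = _
    rw [huc, smul_zero, add_zero]
  have hτ₂ : ∑ k, P.w.coeff D.τ₂ k • F.half D.τ₂ k =
      ∑ j : Fin 3, P.w.coeff D.τ₂ (D.q j.castSucc) • u₂ (f j.castSucc) := by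
    have h1 : ∀ k, F.half D.τ₂ (D.q k) = u₂ (f k) - u₂ bary := fun k => by
      rw [IdealMap.half, ← relabel_faceBary]
      exact hu₂ bary (f k)
    rw [← Equiv.sum_comp D.q]
    simp only [h1, smul_sub]
    rw [Finset.sum_sub_distrib, ← Finset.sum_smul, Equiv.sum_comp D.q (P.w.coeff D.τ₂), hc.sum,
      zero_smul, sub_zero, Fin.sum_univ_castSucc]
    change _ + _ • u₂ c = _
    rw [hu₂c, smul_zero, add_zero]
  -- the new tetrahedra
  have hnew : ∑ j, ∑ k, P'.w.coeff (D.new j) k • F'.half (D.new j) k =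
      ∑ j : Fin 3, P.w.coeff D.τ (D.p j.castSucc) • u (f j.castSucc) +
        ∑ j : Fin 3, P.w.coeff D.τ₂ (D.q j.castSucc) • u₂ (f j.castSucc) := by
    have h1 : ∀ j l : Fin 3, F'.half (D.new j) l.castSucc = u (z j l) - u (m j) := fun j l => by
      rw [IdealMap.half, segFirst j _ _ (hb j) (faceBary_castSucc_le j l), hu]
    -- The face with label `3` is the outer one on the side of `τ₂`, reached after swapping `j` and
    -- `3`. The half starts at `m j` on `t`, where `u₂` may be replaced by `u`.
    have h2 : ∀ j : Fin 3, F'.half (D.new j) 3 = u₂ (f j.castSucc) - u (m j) := fun j => by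
      have := segSecond j bary (f j.castSucc) (hb j) (faceBary_castSucc_le j j)
      rw [relabel_bary, relabel_faceBary, Equiv.swap_apply_left, hu₂,
        bipyramid_faceBary_self] at this
      rw [IdealMap.half, this, ← hm]
    have h3 : ∀ j, ∑ k, P'.w.coeff (D.new j) k • F'.half (D.new j) k =
        ∑ l : Fin 3, P'.w.coeff (D.new j) l.castSucc • u (z j l) +
          P'.w.coeff (D.new j) 3 • u₂ (f j.castSucc) := fun j => by
      have h4 := hc'.sum (D.new j)
      rw [Fin.sum_univ_castSucc] at h4 ⊢
      have h5 : F'.half (D.new j) (Fin.last 3) = u₂ (f j.castSucc) - u (m j) := h2 j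
      simp only [h1, h5, smul_sub, Finset.sum_sub_distrib, ← Finset.sum_smul]
      rw [sub_add_sub_comm, ← add_smul, h4, zero_smul, sub_zero]
      rfl
    -- An inner face is seen from two new tetrahedra at the same point and with opposite
    -- coefficients.
    have h6 : ∀ j l, j ≠ l → P'.w.coeff (D.new l) j.castSucc • u (z l j) =
        -(P'.w.coeff (D.new j) l.castSucc • u (z j l)) := fun j l hjl => by
      have := hc'.eq_neg (hD.new_glue j l hjl)
      rw [Equiv.swap_apply_right] at this
      rw [this, neg_smul, show z l j = z j l from bipyramid_faceBary_comm l j]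
    have h7 : ∀ j, P'.w.coeff (D.new j) j.castSucc • u (z j j) =
        P.w.coeff D.τ (D.p j.castSucc) • u (f j.castSucc) := fun j => by
      have := hcoeff _ _ _ _ (TwoThreeData.Side.first (D := D) j)
      rw [show D.p⁻¹ (D.p j.castSucc) = j.castSucc from D.p.symm_apply_apply _] at this
      rw [this, show z j j = f j.castSucc from bipyramid_faceBary_self j]
    have h8 : ∀ j : Fin 3, P'.w.coeff (D.new j) 3 = P.w.coeff D.τ₂ (D.q j.castSucc) := fun j => by
      have := hcoeff _ _ _ _ (TwoThreeData.Side.second (D := D) j)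
      rw [Equiv.Perm.mul_apply, show D.q⁻¹ (D.q j.castSucc) = j.castSucc from
        D.q.symm_apply_apply _, Equiv.swap_apply_left] at this
      exact this
    simp only [h3, h8, Finset.sum_add_distrib]
    congr 1
    simp only [← h7, Fin.sum_univ_three]
    rw [h6 0 1 (by decide), h6 0 2 (by decide), h6 1 2 (by decide)]
    abel
  refine homologyClass_eq_of_chainClass_eq _ _ ?_
  rw [IdealMap.chainClass, ← Equiv.sum_comp D.e, Fintype.sum_sum_type]
  rw [show ∑ j, ∑ k, P'.w.coeff (D.e (Sum.inr j)) k • F'.half (D.e (Sum.inr j)) k = _ from hnew,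
    ← hτ, ← hτ₂]
  have hold : ∀ i : {i : Fin P.T.gluing.n // i ≠ D.τ ∧ i ≠ P.T.gluing.nbr D.τ (D.p 3)},
      ∑ k, P'.w.coeff (D.e (Sum.inl i)) k • F'.half (D.e (Sum.inl i)) k =
        ∑ k, P.w.coeff i.1 k • F.half i.1 k := fun i => by
    refine Finset.sum_congr rfl fun k _ => ?_
    congr 1
    · exact hcoeff _ _ _ _ (TwoThreeData.Side.kept (D := D) i k)
    · exact IdealMap.seg_congr _ _ fun u => hkept i _
  rw [Finset.sum_congr rfl fun i _ => hold i]
  have hsplit : ∀ g : Fin P.T.gluing.n → ChainClass M,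
      (∑ i : {i : Fin P.T.gluing.n // i ≠ D.τ ∧ i ≠ P.T.gluing.nbr D.τ (D.p 3)}, g i.1) +
        (g D.τ + g D.τ₂) = ∑ i, g i := fun g => by
    rw [← Finset.sum_pair (f := g) (show D.τ ≠ D.τ₂ from D.ne.symm),
      ← Finset.sum_subtype (Finset.univ \ {D.τ, D.τ₂}) (fun i => by
        simp [TwoThreeData.τ₂]) g]
    exact Finset.sum_sdiff (Finset.subset_univ _)
  exact hsplit fun i => ∑ k, P.w.coeff i k • F.half i k

lemma IdealTransitEquiv.homologyClass_eq (h : P.IdealTransitEquiv P') :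
    P'.homologyClass = P.homologyClass := by
  induction h with
  | rel _ _ h =>
    rcases h with h | h | h
    · exact h.homologyClass_eq
    · exact h.homologyClass_eq
    · exact h.homologyClass_eq
  | refl => rfl
  | symm _ _ _ ih => exact ih.symm
  | trans _ _ _ _ _ ih₁ ih₂ => exact ih₂.trans ih₁

end PreBranchedTriangulation

end TwoThree

theorem mainTheorem5 {M : Type} [TopologicalSpace M] [ChartedSpace (EuclideanHalfSpace 3) M]
    [IsManifold (𝓡∂ 3) ∞ M] [CompactSpace M] [T2Space M] [ConnectedSpace M]
    (hM : ((𝓡∂ 3).boundary M).Nonempty) (P : PreBranchedTriangulation M) :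
    (∀ P' : PreBranchedTriangulation M, P.IdealTransitEquiv P' →
      P'.homologyClass = P.homologyClass) ∧
    (reduceModTwo M).hom P.homologyClass = 0 ∧
    (∃ α : H1 ℤ M, P.homologyClass = (2 : ℤ) • α) ∧
    (∀ (o : P.T.gluing.Orientation) (b : P.T.gluing.Branching),
      P.w = b.toPreBranching o → P.homologyClass = 0) := by
  obtain ⟨α, hα⟩ := P.homologyClass_even
  refine ⟨fun P' h => h.homologyClass_eq, ?_, ⟨α, hα⟩, P.homologyClass_eq_zero_of_branching⟩
  rw [hα]
  exact reduceModTwo_two_smul M α
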